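/- **Common prefix lemma (proof-of-stake Nakamoto-style blockchain, synchronous network, static corruption).** *Model.* Slots are natural numbers. A block has a predecessor hash, a slot, a payload and a baker identifier; a chain is a list of blocks, newest first. Fixed are a genesis block with slot $0$ and an honest baker identifier, a hash function on blocks, a lottery predicate $\mathrm{Winner}(p,sl)$, a duplicate-free list $\mathrm{InitParties}$ of participating parties, a predicate $\mathrm{Honest}$ on parties, arbitrary adversarial functions, and for each party its own block tree implementation. We assume that every corrupted party that wins some slot belongs to $\mathrm{InitParties}$. A chain is *valid* if every block's baker wins the block's slot, every block carries the hash of the next block of the list, the last block is the genesis block, and the slots strictly decrease. A block tree $t$ has a set of blocks, initially just the genesis block and growing by each block inserted; $\mathrm{bestChain}(sl,t)$ is a valid chain of blocks of $t$ with slots $\le sl$, and is at least as long as any other such chain. *Execution.* It starts in slot $1$. In each slot all parties are activated for delivery, in an execution order, and then all are activated for baking; then the slot is incremented. Honest parties insert all received blocks into their trees; an honest winner of slot $sl$ bakes a block on top of $\mathrm{bestChain}(sl-1,t)$, inserts it into its tree $t$ and floods it. Whenever a corrupted party is activated, the adversary, who sees all messages sent and all messages in transit, may flood arbitrary blocks.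 Honest messages arrive in the next slot; for each adversarial message and each receiver the adversary chooses arrival in the next slot or the one after. The execution order and the buffer of messages in transit may be permuted at any time. A state is *reachable* if it arises from the initial state $N_0$ by finitely many such steps. Its *block history* consists of the genesis block and all blocks sent so far. A state $N$ is *collision-free* if different blocks of its block history have different hashes, and *forging-free* if in every execution from $N_0$ to $N$, at every activation of a corrupted party, every block sent by the adversary that carries an honest identifier is already in the block history at that moment. A slot is a *super slot* if exactly one party in $\mathrm{InitParties}$ is honest and wins it, and an *adversarial slot* if some party in $\mathrm{InitParties}$ is corrupted and wins it. For a chain $c$, let $\mathrm{prune}_k(c)$ be $c$ without its blocks of slot $>k$; $c_1$ is a *prefix* of $c_2$ if $c_2=c_3 c_1$ (concatenation) for some $c_3$. *Statement.* Let $N$ be a reachable, forging-free and collision-free state in slot $sl$, and let $k$ be a slot. Let $\mathrm{Bad}$ be the event that there is $sl'$ with $1\le sl'\le k$ such that $$\#\{\text{super slots in }[sl',sl-2]\}\;\le\;2\cdot\#\{\text{adversarial slots in }[sl',sl-1]\}.$$ 1. Let $p$ be an honest party in $N$ with tree $t$, and let $c$ be a valid chain of blocks of the block history of $N$, all of slot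 $<sl$, with $|\mathrm{bestChain}(sl-1,t)|\le|c|$. Then $\mathrm{prune}_k(\mathrm{bestChain}(sl-1,t))$ is a prefix of $c$, or $\mathrm{Bad}$ holds. 2. Let $p_1,p_2$ be honest parties in $N$ with trees $t_1,t_2$. Then $\mathrm{prune}_k(\mathrm{bestChain}(sl-1,t_1))$ is a prefix of $\mathrm{bestChain}(sl-1,t_2)$, or $\mathrm{Bad}$ holds. -/

import Mathlib

namespace PoSNSB

universe u v w s t

/-- Time is discretized into slots. -/
abbrev Slot := ℕ

/-- Blocks: the hash of the predecessor, the slot, the payload and the identifier of the baker. -/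
structure Block (Party : Type u) (Txs : Type v) (Hash : Type w) where
  pred : Hash
  slot : Slot
  txs : Txs
  bid : Party

/-- A chain is a list of blocks, the newest block first. -/
abbrev Chain (Party : Type u) (Txs : Type v) (Hash : Type w) := List (Block Party Txs Hash)

/-- The parameters that determine which chains are valid. -/
structure ChainParams (Party : Type u) (Txs : Type v) (Hash : Type w) where
  genesis : Block Party Txs Hash
  hashBlock : Block Party Txs Hash → Hash
  winner : Party → Slot → Bool

section Chains

variable {Party : Type u} {Txs : Type v} {Hash : Type w}

/-- A block is valid if its baker won the lottery for its slot. -/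
def ChainParams.ValidBlock (P : ChainParams Party Txs Hash) (b : Block Party Txs Hash) : Prop :=
  P.winner b.bid b.slot = true

/-- Every block points to the hash of the next block of the list, and the list ends in the genesis
block (in particular it is not empty). -/
def ChainParams.Linked (P : ChainParams Party Txs Hash) : Chain Party Txs Hash → Prop
  | [] => False
  | [b] => b = P.genesis
  | b :: b' :: c => b.pred = P.hashBlock b' ∧ P.Linked (b' :: c)

/-- Valid chains: all blocks are valid, the chain is correctly linked down to the genesis block, and
the slots are strictly decreasing. -/
def ChainParams.ValidChain (P : ChainParams Party Txs Hash) (c : Chain Party Txs Hash) : Prop :=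
  (∀ b ∈ c, P.ValidBlock b) ∧ P.Linked c ∧ (c.map Block.slot).Pairwise (fun x y => y < x)

/-- Pruning: remove all blocks with a slot higher than `sl`. -/
def prune (sl : Slot) (c : Chain Party Txs Hash) : Chain Party Txs Hash :=
  c.filter (fun b => decide (b.slot ≤ sl))

/-- `c₁` is a prefix of `c₂`: there is `c₃` with `c₃ ++ c₁ = c₂` (the oldest block is last). -/
def ChainPrefix (c₁ c₂ : Chain Party Txs Hash) : Prop :=
  ∃ c₃ : Chain Party Txs Hash, c₃ ++ c₁ = c₂

/-- The abstract interface of a block tree. -/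
structure TreeType (P : ChainParams Party Txs Hash) where
  carrier : Type t
  tree0 : carrier
  extendTree : carrier → Block Party Txs Hash → carrier
  allBlocks : carrier → List (Block Party Txs Hash)
  bestChain : Slot → carrier → Chain Party Txs Hash
  instantiated : ∀ b, b ∈ allBlocks tree0 ↔ b ∈ [P.genesis]
  extendable : ∀ (T : carrier) (b b' : Block Party Txs Hash),
    b' ∈ allBlocks (extendTree T b) ↔ b' ∈ allBlocks T ++ [b]
  valid : ∀ (T : carrier) (sl : Slot), P.ValidChain (bestChain sl T)
  optimal : ∀ (c : Chain Party Txs Hash) (T : carrier) (sl : Slot), P.ValidChain c →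
    (∀ b ∈ c, b ∈ allBlocks T ∧ b.slot ≤ sl) → c.length ≤ (bestChain sl T).length
  selfContained : ∀ (T : carrier) (sl : Slot),
    ∀ b ∈ bestChain sl T, b ∈ allBlocks T ∧ b.slot ≤ sl

end Chains

/-- Messages carry blocks. -/
inductive Message (Party : Type u) (Txs : Type v) (Hash : Type w) where
  | blockMsg : Block Party Txs Hash → Message Party Txs Hash

/-- The block in a message. -/
def Message.block {Party : Type u} {Txs : Type v} {Hash : Type w} :
    Message Party Txs Hash → Block Party Txs Hash
  | .blockMsg b => b

/-- The possible delays of a message at the time when it is sent. -/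
inductive Delay where
  | one
  | two

/-- The delay as a number of slots. -/
def Delay.toNat : Delay → ℕ
  | .one => 1
  | .two => 2

/-- The adversary chooses the delay of each message separately for each receiver. -/
abbrev DelayMap (Party : Type u) := Party → Delay

/-- A message in transit with its receiver and its current delay. The delay is `1` or `2` when the
message is sent, it is decremented when the slot is incremented, and the message is due when
the delay is `0`. -/
structure MsgTuple (Party : Type u) (Txs : Type v) (Hash : Type w) where
  msg : Message Party Txs Hash
  rcv : Party
  cd : ℕ

/-- An adversarial reaction: from the current slot, the history of all messages sent, the messages
in transit and the adversarial state, it computes messages to send, with their delays, and a new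
adversarial state. -/
abbrev AdvFun (Party : Type u) (Txs : Type v) (Hash : Type w) (AdvState : Type s) :=
  Slot → List (Message Party Txs Hash) → List (MsgTuple Party Txs Hash) → AdvState →
    List (Message Party Txs Hash × DelayMap Party) × AdvState

/-- All parameters of the protocol and of its environment. -/
structure Protocol (Party : Type u) (Txs : Type v) (Hash : Type w) (AdvState : Type s) extends
    ChainParams Party Txs Hash where
  initParties : List Party
  treeTypeMap : Party → TreeType.{u, v, w, t} toChainParams
  txSelection : Slot → Party → Txs
  honest : Party → Bool
  advState0 : AdvState
  advRcv : AdvFun Party Txs Hash AdvState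
  advBake : AdvFun Party Txs Hash AdvState

/-- The progress made within a slot. -/
inductive Progress where
  | ready
  | delivered
  | baked

/-- The local state of a party. -/
structure LocalState {Party : Type u} {Txs : Type v} {Hash : Type w}
    (P : ChainParams Party Txs Hash) where
  id : Party
  tT : TreeType.{u, v, w, t} P
  tree : tT.carrier

/-- The best chain of a party with respect to a slot. -/
def LocalState.best {Party : Type u} {Txs : Type v} {Hash : Type w}
    {P : ChainParams Party Txs Hash} (l : LocalState P) (sl : Slot) : Chain Party Txs Hash :=
  l.tT.bestChain sl l.tree

/-- Honest reaction to received messages: extend the tree by all received blocks. -/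
def honestRcv {Party : Type u} {Txs : Type v} {Hash : Type w} {P : ChainParams Party Txs Hash}
    (ms : List (Message Party Txs Hash)) (l : LocalState P) : LocalState P :=
  { l with tree := ms.foldl (fun T m => l.tT.extendTree T m.block) l.tree }

/-- Honest baking in slot `sl`: a winner of the slot creates a block on top of its best chain for
slot `sl - 1`, extends its tree by it, and sends it. -/
def honestBake {Party : Type u} {Txs : Type v} {Hash : Type w} {P : ChainParams Party Txs Hash}
    (sl : Slot) (txs : Txs) (l : LocalState P) : List (Message Party Txs Hash) × LocalState P :=
  if P.winner l.id sl = true then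
    let b : Block Party Txs Hash :=
      { pred := P.hashBlock ((l.best (sl - 1)).headD P.genesis)
        slot := sl
        txs := txs
        bid := l.id }
    ([.blockMsg b], { l with tree := l.tT.extendTree l.tree b })
  else ([], l)

/-- Global states. -/
structure GlobalState {Party : Type u} {Txs : Type v} {Hash : Type w} (AdvState : Type s)
    (P : ChainParams Party Txs Hash) where
  slot : Slot
  msgBuff : List (MsgTuple Party Txs Hash)
  stateMap : Party → Option (LocalState.{u, v, w, t} P)
  history : List (Message Party Txs Hash)
  advState : AdvState
  execOrder : List Party
  progress : Progress

/-- The block history: the genesis block and all blocks that have been sent. -/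
def GlobalState.blockHistory {Party : Type u} {Txs : Type v} {Hash : Type w} {AdvState : Type s}
    {P : ChainParams Party Txs Hash} (N : GlobalState AdvState P) : List (Block Party Txs Hash) :=
  P.genesis :: N.history.map Message.block

section Semantics

variable {Party : Type u} {Txs : Type v} {Hash : Type w} {AdvState : Type s}

/-- Honest flooding: every message is sent to every party with delay `1`. -/
def floodMsgs {P : ChainParams Party Txs Hash} (ms : List (Message Party Txs Hash))
    (N : GlobalState AdvState P) : GlobalState AdvState P :=
  { N with
    msgBuff := N.msgBuff ++ ms.flatMap (fun m => N.execOrder.map (fun q => ⟨m, q, 1⟩))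
    history := N.history ++ ms }

/-- Adversarial flooding: every message is sent to every party with the chosen delay. -/
def floodMsgsAdv {P : ChainParams Party Txs Hash}
    (ms : List (Message Party Txs Hash × DelayMap Party))
    (N : GlobalState AdvState P) : GlobalState AdvState P :=
  { N with
    msgBuff := N.msgBuff ++
      ms.flatMap (fun m => N.execOrder.map (fun q => ⟨m.1, q, (m.2 q).toNat⟩))
    history := N.history ++ ms.map Prod.fst }

variable [DecidableEq Party]

/-- The message tuple is to be delivered to `p` in the current slot. -/
def MsgTuple.dueFor (p : Party) (m : MsgTuple Party Txs Hash) : Bool :=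
  decide (m.rcv = p ∧ m.cd = 0)

/-- Replace the local state of `p`. -/
def GlobalState.setState {P : ChainParams Party Txs Hash} (N : GlobalState AdvState P) (p : Party)
    (l : LocalState P) : GlobalState AdvState P :=
  { N with stateMap := Function.update N.stateMap p (some l) }

/-- The initial state. The genesis block occupies slot `0`, and the execution starts in slot `1`. -/
def Protocol.init (P : Protocol Party Txs Hash AdvState) : GlobalState AdvState P.toChainParams where
  slot := 1
  msgBuff := []
  stateMap := fun p =>
    if p ∈ P.initParties then some ⟨p, P.treeTypeMap p, (P.treeTypeMap p).tree0⟩ else none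
  history := []
  advState := P.advState0
  execOrder := P.initParties
  progress := .ready

/-- What the adversary computes when a corrupted party is activated for delivery in `N`. -/
def Protocol.advRcvOut (P : Protocol Party Txs Hash AdvState)
    (N : GlobalState AdvState P.toChainParams) :
    List (Message Party Txs Hash × DelayMap Party) × AdvState :=
  P.advRcv N.slot N.history N.msgBuff N.advState

/-- What the adversary computes when a corrupted party is activated for baking in `N`. -/
def Protocol.advBakeOut (P : Protocol Party Txs Hash AdvState)
    (N : GlobalState AdvState P.toChainParams) :
    List (Message Party Txs Hash × DelayMap Party) × AdvState :=
  P.advBake N.slot N.history N.msgBuff N.advState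

/-- Activation of `p` for delivery: the messages due for `p` leave the buffer; an honest party
extends its tree, for a corrupted party the adversary reacts. -/
def Protocol.rcvParty (P : Protocol Party Txs Hash AdvState)
    (N : GlobalState AdvState P.toChainParams) (p : Party) : GlobalState AdvState P.toChainParams :=
  let N' := { N with msgBuff := N.msgBuff.filter (fun m => !(m.dueFor p)) }
  if P.honest p = true then
    match N.stateMap p with
    | none => N'
    | some l =>
      N'.setState p (honestRcv ((N.msgBuff.filter (MsgTuple.dueFor p)).map MsgTuple.msg) l)
  else
    floodMsgsAdv (P.advRcvOut N).1 { N' with advState := (P.advRcvOut N).2 }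

/-- Activation of `p` for baking. -/
def Protocol.bakeParty (P : Protocol Party Txs Hash AdvState)
    (N : GlobalState AdvState P.toChainParams) (p : Party) : GlobalState AdvState P.toChainParams :=
  if P.honest p = true then
    match N.stateMap p with
    | none => N
    | some l =>
      let r := honestBake N.slot (P.txSelection N.slot p) l
      floodMsgs r.1 (N.setState p r.2)
  else
    floodMsgsAdv (P.advBakeOut N).1 { N with advState := (P.advBakeOut N).2 }

/-- All parties are activated for delivery in the execution order. -/
def Protocol.receive (P : Protocol Party Txs Hash AdvState)
    (N : GlobalState AdvState P.toChainParams) : GlobalState AdvState P.toChainParams :=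
  { N.execOrder.foldl P.rcvParty N with progress := .delivered }

/-- All parties are activated for baking in the execution order. -/
def Protocol.bake (P : Protocol Party Txs Hash AdvState)
    (N : GlobalState AdvState P.toChainParams) : GlobalState AdvState P.toChainParams :=
  { N.execOrder.foldl P.bakeParty N with progress := .baked }

/-- The next slot begins. -/
def increment {P : ChainParams Party Txs Hash} (N : GlobalState AdvState P) :
    GlobalState AdvState P :=
  { N with
    slot := N.slot + 1
    msgBuff := N.msgBuff.map (fun m => { m with cd := m.cd - 1 })
    progress := .ready }

/-- Atomic steps. -/
inductive Protocol.Step (P : Protocol Party Txs Hash AdvState) :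
    GlobalState AdvState P.toChainParams → GlobalState AdvState P.toChainParams → Prop
  | receive (N) : N.progress = .ready → P.Step N (P.receive N)
  | bake (N) : N.progress = .delivered → P.Step N (P.bake N)
  | increment (N) : N.progress = .baked → P.Step N (increment N)
  | permExec (N) (o : List Party) : N.execOrder.Perm o → P.Step N { N with execOrder := o }
  | permBuff (N) (ms : List (MsgTuple Party Txs Hash)) : N.msgBuff.Perm ms →
      P.Step N { N with msgBuff := ms }

/-- Reachability: the reflexive transitive closure of atomic steps. -/
def Protocol.Reachable (P : Protocol Party Txs Hash AdvState)
    (N₁ N₂ : GlobalState AdvState P.toChainParams) : Prop :=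
  Relation.ReflTransGen P.Step N₁ N₂

/-- No two different blocks of the block history have the same hash. -/
def CollisionFree {P : ChainParams Party Txs Hash} (N : GlobalState AdvState P) : Prop :=
  ∀ b ∈ N.blockHistory, ∀ b' ∈ N.blockHistory, P.hashBlock b = P.hashBlock b' → b = b'

/-- When the adversary sends `ms` in `N`, every block in `ms` that bears the identifier of an honest
party is already in the block history of `N`. -/
def Protocol.NoForgery (P : Protocol Party Txs Hash AdvState)
    (N : GlobalState AdvState P.toChainParams)
    (ms : List (Message Party Txs Hash × DelayMap Party)) : Prop :=
  ∀ m ∈ ms, P.honest m.1.block.bid = true → m.1.block ∈ N.blockHistory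

/-- `N` is forging-free: in every execution from the initial state to `N`, no activation of a
corrupted party, for delivery or for baking, sends a forged block. The state in which `p` is
activated during a delivery or baking step from `N'` is the one after the activations of the
parties `xs` before `p` in the execution order. -/
def Protocol.ForgingFree (P : Protocol Party Txs Hash AdvState)
    (N : GlobalState AdvState P.toChainParams) : Prop :=
  ∀ N', P.Reachable P.init N' → ∀ (xs : List Party) (p : Party) (ys : List Party),
    N'.execOrder = xs ++ p :: ys → P.honest p = false →
    (N'.progress = .ready → P.Reachable (P.receive N') N →
      P.NoForgery (xs.foldl P.rcvParty N') (P.advRcvOut (xs.foldl P.rcvParty N')).1) ∧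
    (N'.progress = .delivered → P.Reachable (P.bake N') N →
      P.NoForgery (xs.foldl P.bakeParty N') (P.advBakeOut (xs.foldl P.bakeParty N')).1)

end Semantics

section Slots

variable {Party : Type u} {Txs : Type v} {Hash : Type w} {AdvState : Type s}

/-- Exactly one participating honest party wins the slot. -/
def Protocol.SuperSlot (P : Protocol Party Txs Hash AdvState) (sl : Slot) : Prop :=
  ∃! p, p ∈ P.initParties ∧ P.winner p sl = true ∧ P.honest p = true

/-- Some participating corrupted party wins the slot. -/
def Protocol.AdvSlot (P : Protocol Party Txs Hash AdvState) (sl : Slot) : Prop :=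
  ∃ p, p ∈ P.initParties ∧ P.winner p sl = true ∧ P.honest p = false

open scoped Classical in
/-- The number of super slots `x` with `i ≤ x < j`. -/
noncomputable def Protocol.numSuper (P : Protocol Party Txs Hash AdvState) (i j : Slot) : ℕ :=
  ((Finset.Ico i j).filter (fun x => P.SuperSlot x)).card

open scoped Classical in
/-- The number of adversarial slots `x` with `i ≤ x < j`. -/
noncomputable def Protocol.numAdv (P : Protocol Party Txs Hash AdvState) (i j : Slot) : ℕ :=
  ((Finset.Ico i j).filter (fun x => P.AdvSlot x)).card

/-- The bad event at the cut `k` in slot `sl`: for some `sl'` with `1 ≤ sl' ≤ k`, the number of super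
slots in `[sl', sl - 2]` is at most twice the number of adversarial slots in `[sl', sl - 1]`. -/
def Protocol.BadEvent (P : Protocol Party Txs Hash AdvState) (k sl : Slot) : Prop :=
  ∃ sl' : Slot, 1 ≤ sl' ∧ sl' ≤ k ∧ P.numSuper sl' (sl - 1) ≤ 2 * P.numAdv sl' sl

end Slots

end PoSNSB

/-!
The argument compares heights of blocks, where the height of a block is the length of the chain that
ends in it. Predecessor hashes determine this chain as long as there are no collisions
(`ChainParams.ChainTo.unique`).

*Invariants.* Two delivery guarantees are maintained along an execution: every block that has been
sent reaches every honest party within two slots, and every block in the tree of an honest party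
after delivery reaches every other honest party in the next slot. `Pending` expresses both.
Hence, when an honest party bakes, all honest blocks of earlier slots are in its tree together with
their chains. Since the best chain is a longest one, an honest block is higher than all honest
blocks of earlier slots (`bakeParty_winner_inv`). In particular, honest blocks of the same height
have the same slot, and if that slot is a super slot, they coincide. Moreover, the best chain of an
honest party in slot `sl` has at least the height of every honest block of slot at most `sl - 2`
(`Protocol.Inv.exists_height`). All this is collected in `Protocol.Inv`, which holds for all states
on an execution that ends in a forging-free and collision-free state (`inv_of_reachable`): states
on the way inherit both properties from the last one.

*Common prefix.* Let `c₁` and `c₂` be two valid chains that are at least as high as all honest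
blocks of super slots up to `sl - 2`, and let `b₀` be their newest common honest block, which exists
because both contain the genesis block. If `b₀` has slot at least `k`, then pruning `c₁` at `k`
leaves a prefix of the common chain of `b₀`. Otherwise let `sl'` be the slot after that of `b₀`. The
honest block of a super slot in `[sl', sl - 2]` is higher than `b₀`, and at its height the chains
`c₁` and `c₂` cannot both have an honest block: it would be the same one, newer than `b₀`. So one
of them has a corrupted block there. Different super slots give different heights, and corrupted
blocks of one chain at different heights occupy different adversarial slots, so that each of the two
chains accounts for at most as many super slots as there are adversarial slots in `[sl', sl - 1]`
(`card_corruptAt_le`). This is the bad event (`chainPrefix_or_badEvent`).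
-/

namespace PoSNSB

universe u v w s t

variable {Party : Type u} {Txs : Type v} {Hash : Type w} {AdvState : Type s}

/-! ### Valid chains -/

/-- `c` is a valid chain with newest block `b`, all of whose blocks lie in `S`. -/
def ChainParams.ChainTo (P : ChainParams Party Txs Hash) (S : Set (Block Party Txs Hash))
    (b : Block Party Txs Hash) (c : Chain Party Txs Hash) : Prop :=
  P.ValidChain c ∧ (∀ x ∈ c, x ∈ S) ∧ c.head? = some b

/-- The hash function is injective on `S`. -/
abbrev ChainParams.HashInjOn (P : ChainParams Party Txs Hash) (S : Set (Block Party Txs Hash)) :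
    Prop :=
  ∀ b ∈ S, ∀ b' ∈ S, P.hashBlock b = P.hashBlock b' → b = b'

section ValidChains

variable {P : ChainParams Party Txs Hash}

lemma ChainParams.ValidChain.ne_nil {c : Chain Party Txs Hash} (h : P.ValidChain c) : c ≠ [] := by
  rintro rfl
  exact h.2.1

lemma ChainParams.ValidChain.of_suffix {c c' : Chain Party Txs Hash} (h : P.ValidChain c)
    (hs : c' <:+ c) (hne : c' ≠ []) : P.ValidChain c' := by
  obtain ⟨a, rfl⟩ := hs
  induction a with
  | nil => exact h
  | cons x a ih =>
    apply ih
    obtain ⟨h1, h2, h3⟩ := h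
    refine ⟨fun b hb => h1 b (List.mem_cons_of_mem _ hb), ?_, ?_⟩
    · rw [List.cons_append] at h2
      rcases hac : a ++ c' with _ | ⟨y, l⟩
      · simp_all
      · rw [hac] at h2
        exact h2.2
    · rw [List.cons_append, List.map_cons, List.pairwise_cons] at h3
      exact h3.2

lemma ChainParams.ValidChain.genesis_mem {c : Chain Party Txs Hash} (h : P.ValidChain c) :
    P.genesis ∈ c := by
  have h2 := h.2.1
  clear h
  induction c with
  | nil => exact h2.elim
  | cons x c ih =>
    cases c with
    | nil =>
      have : x = P.genesis := h2
      simp [this]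
    | cons y c => exact List.mem_cons_of_mem _ (ih h2.2)

lemma ChainParams.ValidChain.slot_lt_of_mem_tail {b : Block Party Txs Hash}
    {c : Chain Party Txs Hash} (h : P.ValidChain (b :: c)) {x : Block Party Txs Hash}
    (hx : x ∈ c) : x.slot < b.slot := by
  have h3 := h.2.2
  rw [List.map_cons, List.pairwise_cons] at h3
  exact h3.1 _ (List.mem_map_of_mem hx)

lemma ChainParams.ValidChain.slot_le_of_head {b : Block Party Txs Hash}
    {c : Chain Party Txs Hash} (h : P.ValidChain c) (hb : c.head? = some b)
    {x : Block Party Txs Hash} (hx : x ∈ c) : x.slot ≤ b.slot := by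
  cases c with
  | nil => simp at hx
  | cons y c =>
    obtain rfl : y = b := by simpa using hb
    rcases List.mem_cons.1 hx with rfl | hx
    · exact le_rfl
    · exact (h.slot_lt_of_mem_tail hx).le

lemma ChainParams.ValidChain.eq_of_slot_eq {c : Chain Party Txs Hash} (h : P.ValidChain c)
    {x y : Block Party Txs Hash} (hx : x ∈ c) (hy : y ∈ c) (hxy : x.slot = y.slot) : x = y := by
  by_contra hne
  have h3 := List.pairwise_map.1 h.2.2
  have key : ∀ ⦃x⦄, x ∈ c → ∀ ⦃y⦄, y ∈ c → x ≠ y → x.slot ≠ y.slot :=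
    List.Pairwise.forall_of_forall_of_flip (fun _ _ hne => absurd rfl hne)
      (h3.imp fun hlt _ => hlt.ne') (h3.imp fun hlt _ => hlt.ne)
  exact key hx hy hne hxy

/-- The predecessor hashes determine a chain from its newest block. The genesis block has
no proper predecessor because of its slot `0`. -/
lemma ChainParams.ChainTo.unique {S : Set (Block Party Txs Hash)} (hg : P.genesis.slot = 0)
    (hS : P.HashInjOn S) {b : Block Party Txs Hash} {c c' : Chain Party Txs Hash}
    (h : P.ChainTo S b c) (h' : P.ChainTo S b c') : c = c' := by
  induction c generalizing c' b with
  | nil => exact absurd rfl h.1.ne_nil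
  | cons x c ih =>
    obtain ⟨hv, hm, hh⟩ := h
    obtain ⟨hv', hm', hh'⟩ := h'
    obtain rfl : x = b := by simpa using hh
    cases c' with
    | nil => exact absurd rfl hv'.ne_nil
    | cons x' c' =>
      obtain rfl : x' = x := by simpa using hh'
      have hgen : ∀ {y : Block Party Txs Hash} {l : Chain Party Txs Hash},
          P.ValidChain (x' :: y :: l) → x' ≠ P.genesis := by
        rintro y l hl rfl
        have := hl.slot_lt_of_mem_tail (List.mem_cons_self (a := y))
        lia
      cases c with
      | nil =>
        cases c' with
        | nil => rfl
        | cons y' c' => exact absurd hv.2.1 (hgen hv')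
      | cons y c =>
        cases c' with
        | nil => exact absurd hv'.2.1 (hgen hv)
        | cons y' c' =>
          have hy : y = y' := hS y (hm y (by simp)) y' (hm' y' (by simp))
            (hv.2.1.1.symm.trans hv'.2.1.1)
          subst hy
          rw [ih (b := y) (c' := y :: c')
            ⟨hv.of_suffix (List.suffix_cons _ _) (by simp),
              fun z hz => hm z (List.mem_cons_of_mem _ hz), rfl⟩
            ⟨hv'.of_suffix (List.suffix_cons _ _) (by simp),
              fun z hz => hm' z (List.mem_cons_of_mem _ hz), rfl⟩]

/-- Slots decrease along a valid chain, so pruning only removes its newest blocks. -/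
lemma prune_suffix {c : Chain Party Txs Hash} (h : (c.map Block.slot).Pairwise fun x y => y < x)
    (k : Slot) : prune k c <:+ c := by
  induction c with
  | nil => simp [prune]
  | cons x c ih =>
    rw [List.map_cons, List.pairwise_cons] at h
    by_cases hx : x.slot ≤ k
    · have : prune k (x :: c) = x :: c := by
        refine List.filter_eq_self.2 fun y hy => ?_
        rcases List.mem_cons.1 hy with rfl | hy
        · simpa using hx
        · have := h.1 _ (List.mem_map_of_mem hy)
          simp only [decide_eq_true_eq]
          lia
      rw [this]
    · have : prune k (x :: c) = prune k c := by simp [prune, hx]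
      rw [this]
      exact (ih h.2).trans (List.suffix_cons _ _)

/-- Above a block `b` of slot at least `k`, nothing survives pruning. -/
lemma prune_suffix_of_le {b : Block Party Txs Hash} {c d : Chain Party Txs Hash}
    (h : P.ValidChain c) (hd : b :: d <:+ c) {k : Slot} (hk : k ≤ b.slot) :
    prune k c <:+ b :: d := by
  have hv := h.of_suffix hd (by simp)
  obtain ⟨a, rfl⟩ := hd
  have ha : prune k a = [] := by
    refine List.filter_eq_nil_iff.2 fun x hx => ?_
    have := List.pairwise_append.1 (List.pairwise_map.1 h.2.2)
    have := this.2.2 x hx b (by simp)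
    simp only [decide_eq_true_eq]
    lia
  have : prune k (a ++ b :: d) = prune k a ++ prune k (b :: d) := List.filter_append ..
  rw [this, ha, List.nil_append]
  exact prune_suffix hv.2.2 k

/-- Some block `y` of the chain has the same height as the newest block of a chain of length
`n`. It is newer than the blocks of smaller height. -/
lemma exists_suffix_of_length {c : Chain Party Txs Hash} (h : P.ValidChain c)
    {b : Block Party Txs Hash} {d : Chain Party Txs Hash} (hd : b :: d <:+ c) {n : ℕ}
    (hdn : (b :: d).length < n) (hn : n ≤ c.length) :
    ∃ y t, y :: t <:+ c ∧ (y :: t).length = n ∧ b.slot < y.slot := by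
  have hs : c.drop (c.length - n) <:+ c := List.drop_suffix _ _
  have hl : (c.drop (c.length - n)).length = n := by
    rw [List.length_drop]
    lia
  rcases hc : c.drop (c.length - n) with _ | ⟨y, t⟩
  · rw [hc] at hl
    simp at hl
    lia
  · rw [hc] at hs hl
    refine ⟨y, t, hs, hl, ?_⟩
    have hsub := List.suffix_of_suffix_length_le hd hs (by lia)
    have hv := h.of_suffix hs (by simp)
    rcases List.suffix_cons_iff.1 hsub with heq | hsub
    · rw [heq] at hdn
      lia
    · exact hv.slot_lt_of_mem_tail (hsub.subset (by simp))

lemma ChainParams.ChainTo.of_suffix {S : Set (Block Party Txs Hash)} {c : Chain Party Txs Hash}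
    (h : P.ValidChain c) (hS : ∀ x ∈ c, x ∈ S) {y : Block Party Txs Hash}
    {t : Chain Party Txs Hash} (hs : y :: t <:+ c) : P.ChainTo S y (y :: t) :=
  ⟨h.of_suffix hs (by simp), fun x hx => hS x (hs.subset hx), rfl⟩

lemma exists_suffix_of_mem {c : Chain Party Txs Hash} {b : Block Party Txs Hash} (hb : b ∈ c) :
    ∃ d, b :: d <:+ c := by
  obtain ⟨a, d, rfl⟩ := List.append_of_mem hb
  exact ⟨d, a, rfl⟩

/-- A block baked on top of a valid chain extends it to a valid chain. -/
lemma ChainParams.ValidChain.cons {c : Chain Party Txs Hash} (h : P.ValidChain c)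
    {b : Block Party Txs Hash} (hb : P.ValidBlock b)
    (hp : b.pred = P.hashBlock (c.headD P.genesis)) (hs : ∀ x ∈ c, x.slot < b.slot) :
    P.ValidChain (b :: c) := by
  refine ⟨?_, ?_, ?_⟩
  · intro x hx
    rcases List.mem_cons.1 hx with rfl | hx
    · exact hb
    · exact h.1 x hx
  · cases c with
    | nil => exact absurd rfl h.ne_nil
    | cons y c => exact ⟨hp, h.2.1⟩
  · rw [List.map_cons, List.pairwise_cons]
    refine ⟨?_, h.2.2⟩
    intro n hn
    obtain ⟨x, hx, rfl⟩ := List.mem_map.1 hn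
    exact hs x hx

end ValidChains

/-! ### Trees, flooding and activations -/

/-- The blocks in the tree of a party. -/
def LocalState.blocks {P : ChainParams Party Txs Hash} (l : LocalState.{u, v, w, t} P) :
    List (Block Party Txs Hash) :=
  l.tT.allBlocks l.tree

section Flooding

variable {P : ChainParams Party Txs Hash}

/-- The block that an honest winner with local state `l` bakes in slot `sl`. -/
def bakedBlock (sl : Slot) (txs : Txs)
    (l : LocalState.{u, v, w, t} P) : Block Party Txs Hash where
  pred := P.hashBlock ((l.best (sl - 1)).headD P.genesis)
  slot := sl
  txs := txs
  bid := l.id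

/-- The local state `l` after insertion of the block `b`. -/
def LocalState.insert (l : LocalState.{u, v, w, t} P)
    (b : Block Party Txs Hash) : LocalState.{u, v, w, t} P :=
  { l with tree := l.tT.extendTree l.tree b }

lemma LocalState.mem_blocks_insert {l : LocalState.{u, v, w, t} P} {b b' : Block Party Txs Hash} :
    b' ∈ (l.insert b).blocks ↔ b' ∈ l.blocks ∨ b' = b := by
  simp [LocalState.insert, LocalState.blocks, l.tT.extendable]

lemma mem_blocks_honestRcv {ms : List (Message Party Txs Hash)} {l : LocalState.{u, v, w, t} P}
    {b : Block Party Txs Hash} :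
    b ∈ (honestRcv ms l).blocks ↔ b ∈ l.blocks ∨ ∃ m ∈ ms, m.block = b := by
  suffices h : ∀ T : l.tT.carrier,
      b ∈ l.tT.allBlocks (ms.foldl (fun T m => l.tT.extendTree T m.block) T) ↔
        b ∈ l.tT.allBlocks T ∨ ∃ m ∈ ms, m.block = b from h l.tree
  induction ms with
  | nil => simp
  | cons m ms ih =>
    intro T
    rw [List.foldl_cons, ih, l.tT.extendable]
    simp [or_assoc, eq_comm (a := b)]

lemma mem_blockHistory {N : GlobalState.{u, v, w, s, t} AdvState P}
    {b : Block Party Txs Hash} :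
    b ∈ N.blockHistory ↔ b = P.genesis ∨ ∃ m ∈ N.history, m.block = b := by
  simp [GlobalState.blockHistory]

lemma blockHistory_mono {N N' : GlobalState.{u, v, w, s, t} AdvState P}
    (h : N.history ⊆ N'.history) : N.blockHistory ⊆ N'.blockHistory :=
  List.cons_subset_cons _ (List.map_subset _ h)

/-- Honest flooding is flooding with delay `1` for every receiver. -/
lemma floodMsgs_eq (ms : List (Message Party Txs Hash))
    (N : GlobalState.{u, v, w, s, t} AdvState P) :
    floodMsgs ms N = floodMsgsAdv (ms.map fun m => (m, fun _ => Delay.one)) N := by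
  simp [floodMsgs, floodMsgsAdv, List.flatMap_map, Delay.toNat, Function.comp_def]

lemma mem_blockHistory_floodMsgsAdv {ms : List (Message Party Txs Hash × DelayMap Party)}
    {N : GlobalState.{u, v, w, s, t} AdvState P} {b : Block Party Txs Hash} :
    b ∈ (floodMsgsAdv ms N).blockHistory ↔ b ∈ N.blockHistory ∨ ∃ m ∈ ms, m.1.block = b := by
  simp only [mem_blockHistory, floodMsgsAdv, List.mem_append, List.mem_map, or_assoc]
  constructor
  · rintro (h | ⟨m, h | ⟨a, ha, rfl⟩, hm⟩)
    · exact .inl h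
    · exact .inr (.inl ⟨m, h, hm⟩)
    · exact .inr (.inr ⟨a, ha, hm⟩)
  · rintro (h | ⟨m, h, hm⟩ | ⟨a, ha, hm⟩)
    · exact .inl h
    · exact .inr ⟨m, .inl h, hm⟩
    · exact .inr ⟨a.1, .inr ⟨a, ha, rfl⟩, hm⟩

lemma mem_msgBuff_floodMsgsAdv {ms : List (Message Party Txs Hash × DelayMap Party)}
    {N : GlobalState.{u, v, w, s, t} AdvState P} {m : MsgTuple Party Txs Hash} :
    m ∈ (floodMsgsAdv ms N).msgBuff ↔ m ∈ N.msgBuff ∨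
      ∃ a ∈ ms, ∃ q ∈ N.execOrder, (⟨a.1, q, (a.2 q).toNat⟩ : MsgTuple _ _ _) = m := by
  simp [floodMsgsAdv]

lemma Delay.one_le_toNat (d : Delay) : 1 ≤ d.toNat := by cases d <;> simp [Delay.toNat]

lemma Delay.toNat_le_two (d : Delay) : d.toNat ≤ 2 := by cases d <;> simp [Delay.toNat]

/-- The party `r`, if it has a local state, has the block `b` in its tree, or a message with `b`
for `r` is in transit and fewer than `d` slot increments are needed until it is due.
In particular `Pending N 0 r b` means that `b` is in the tree. -/
def Pending (N : GlobalState.{u, v, w, s, t} AdvState P) (d : ℕ) (r : Party)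
    (b : Block Party Txs Hash) : Prop :=
  ∀ l, N.stateMap r = some l →
    b ∈ l.blocks ∨ ∃ m ∈ N.msgBuff, m.rcv = r ∧ m.msg.block = b ∧ m.cd < d

lemma Pending.mono {N : GlobalState.{u, v, w, s, t} AdvState P} {d d' : ℕ} (hd : d ≤ d')
    {r : Party} {b : Block Party Txs Hash} (h : Pending N d r b) : Pending N d' r b := by
  intro l hl
  rcases h l hl with h | ⟨m, h1, h2, h3, h4⟩
  · exact .inl h
  · exact .inr ⟨m, h1, h2, h3, by omega⟩

lemma Pending.mem {N : GlobalState.{u, v, w, s, t} AdvState P} {r : Party}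
    {b : Block Party Txs Hash} (h : Pending N 0 r b) {l : LocalState P}
    (hl : N.stateMap r = some l) : b ∈ l.blocks := by
  rcases h l hl with h | ⟨m, h1, h2, h3, h4⟩
  · exact h
  · omega

lemma Pending.flood {N : GlobalState.{u, v, w, s, t} AdvState P}
    (ms : List (Message Party Txs Hash × DelayMap Party)) {d : ℕ} {r : Party}
    {b : Block Party Txs Hash} (h : Pending N d r b) : Pending (floodMsgsAdv ms N) d r b := by
  intro l hl
  rcases h l hl with h | ⟨m, h1, h2⟩
  · exact .inl h
  · exact .inr ⟨m, mem_msgBuff_floodMsgsAdv.2 (.inl h1), h2⟩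

lemma pending_floodMsgsAdv {N : GlobalState.{u, v, w, s, t} AdvState P}
    {ms : List (Message Party Txs Hash × DelayMap Party)}
    {a : Message Party Txs Hash × DelayMap Party} (ha : a ∈ ms) {d : ℕ} {r : Party}
    (hr : ∀ l, N.stateMap r = some l → r ∈ N.execOrder) (hd : (a.2 r).toNat < d) :
    Pending (floodMsgsAdv ms N) d r a.1.block :=
  fun l hl => .inr ⟨_, mem_msgBuff_floodMsgsAdv.2 (.inr ⟨a, ha, r, hr l hl, rfl⟩), rfl, rfl, hd⟩

lemma Pending.increment {N : GlobalState.{u, v, w, s, t} AdvState P} {d : ℕ} {r : Party}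
    {b : Block Party Txs Hash} (h : Pending N (d + 1 + 1) r b) :
    Pending (increment N) (d + 1) r b := by
  intro l hl
  refine (h l hl).imp_right ?_
  rintro ⟨m, hm, h1, h2, h3⟩
  exact ⟨_, List.mem_map_of_mem hm, h1, h2, by simp only; omega⟩

end Flooding

section Activations

variable [DecidableEq Party] {P : Protocol.{u, v, w, s, t} Party Txs Hash AdvState}

lemma rcvParty_honest {N : GlobalState AdvState P.toChainParams} {p : Party}
    (hp : P.honest p = true) {l : LocalState P.toChainParams} (hl : N.stateMap p = some l) :
    P.rcvParty N p = GlobalState.setState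
      { N with msgBuff := N.msgBuff.filter fun m => !(m.dueFor p) } p
      (honestRcv ((N.msgBuff.filter (MsgTuple.dueFor p)).map MsgTuple.msg) l) := by
  simp [Protocol.rcvParty, hp, hl]

lemma rcvParty_corrupt {N : GlobalState AdvState P.toChainParams} {p : Party}
    (hp : P.honest p = false) :
    P.rcvParty N p = floodMsgsAdv (P.advRcvOut N).1
      { N with
        msgBuff := N.msgBuff.filter fun m => !(m.dueFor p)
        advState := (P.advRcvOut N).2 } := by
  simp [Protocol.rcvParty, hp]

lemma bakeParty_corrupt {N : GlobalState AdvState P.toChainParams} {p : Party}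
    (hp : P.honest p = false) :
    P.bakeParty N p = floodMsgsAdv (P.advBakeOut N).1
      { N with advState := (P.advBakeOut N).2 } := by
  simp [Protocol.bakeParty, hp]

lemma bakeParty_honest_loser {N : GlobalState AdvState P.toChainParams} {p : Party}
    (hp : P.honest p = true) {l : LocalState P.toChainParams} (hl : N.stateMap p = some l)
    (hw : ¬ P.winner l.id N.slot = true) : P.bakeParty N p = N := by
  have : Function.update N.stateMap p (some l) = N.stateMap := by
    rw [← hl, Function.update_eq_self]
  simp [Protocol.bakeParty, hp, hl, honestBake, hw, floodMsgs, GlobalState.setState, this]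

lemma bakeParty_honest_winner {N : GlobalState AdvState P.toChainParams} {p : Party}
    (hp : P.honest p = true) {l : LocalState P.toChainParams} (hl : N.stateMap p = some l)
    (hw : P.winner l.id N.slot = true) :
    P.bakeParty N p =
      (floodMsgsAdv [(.blockMsg (bakedBlock N.slot (P.txSelection N.slot p) l),
        fun _ => Delay.one)] N).setState p
          (l.insert (bakedBlock N.slot (P.txSelection N.slot p) l)) := by
  simp [GlobalState.setState, floodMsgsAdv, Protocol.bakeParty, hp, hl, honestBake, hw,
    floodMsgs_eq, bakedBlock, LocalState.insert]

lemma history_subset_bakeParty (N : GlobalState AdvState P.toChainParams) (p : Party) :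
    N.history ⊆ (P.bakeParty N p).history := by
  unfold Protocol.bakeParty
  split
  · split
    · exact List.Subset.refl _
    · exact List.subset_append_left _ _
  · exact List.subset_append_left _ _

lemma history_subset_rcvParty (N : GlobalState AdvState P.toChainParams) (p : Party) :
    N.history ⊆ (P.rcvParty N p).history := by
  unfold Protocol.rcvParty
  dsimp only
  split
  · split <;> exact List.Subset.refl _
  · exact List.subset_append_left _ _

end Activations

/-! ### Invariants of the execution -/

/-- The part of the invariant that concerns parties, trees and the buffer in every phase. -/
structure Protocol.StateInv (P : Protocol.{u, v, w, s, t} Party Txs Hash AdvState)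
    (N : GlobalState AdvState P.toChainParams) : Prop where
  perm : N.execOrder.Perm P.initParties
  mem_init : ∀ p l, N.stateMap p = some l → p ∈ P.initParties
  id_eq : ∀ p l, N.stateMap p = some l → l.id = p
  exists_state : ∀ p ∈ P.initParties, ∃ l, N.stateMap p = some l
  tree_sub : ∀ p l, N.stateMap p = some l → ∀ b ∈ l.blocks, b ∈ N.blockHistory
  buff_sub : ∀ m ∈ N.msgBuff, m.msg.block ∈ N.blockHistory

/-- The part of the invariant that concerns the honest blocks of the block history. In each slot
an honest party bakes at most one block, exactly one if it won a slot that is over, and honest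
blocks of later slots have greater height. Heights are measured by chains within a fixed set `S`,
in applications the block history of the last state of the execution. -/
structure Protocol.HistInv (P : Protocol.{u, v, w, s, t} Party Txs Hash AdvState)
    (S : Set (Block Party Txs Hash)) (N : GlobalState AdvState P.toChainParams) : Prop where
  slot_pos : 1 ≤ N.slot
  slot_le : ∀ b ∈ N.blockHistory, P.honest b.bid = true → b.slot ≤ N.slot
  genesis_or : ∀ b ∈ N.blockHistory, P.honest b.bid = true →
    b = P.genesis ∨ 1 ≤ b.slot ∧ b.bid ∈ P.initParties
  unique : ∀ b ∈ N.blockHistory, ∀ b' ∈ N.blockHistory, P.honest b.bid = true →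
    b.bid = b'.bid → b.slot = b'.slot → b = b'
  exists_block : ∀ p ∈ P.initParties, P.honest p = true → ∀ x, 1 ≤ x → x < N.slot →
    P.winner p x = true → ∃ b ∈ N.blockHistory, b.bid = p ∧ b.slot = x
  growth : ∀ b ∈ N.blockHistory, ∀ b' ∈ N.blockHistory, P.honest b.bid = true →
    P.honest b'.bid = true → b.slot < b'.slot →
    ∀ c c', P.ChainTo S b c → P.ChainTo S b' c' → c.length < c'.length

/-- There is a valid chain with newest block `b` all of whose blocks are in the tree of `r` or
reach `r` within the bound `d r`, for every honest party `r`. -/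
def Protocol.Known (P : Protocol.{u, v, w, s, t} Party Txs Hash AdvState)
    (N : GlobalState AdvState P.toChainParams) (d : Party → ℕ) (b : Block Party Txs Hash) : Prop :=
  ∃ c, P.ValidChain c ∧ c.head? = some b ∧
    ∀ r, P.honest r = true → ∀ x ∈ c, Pending N (d r) r x

/-- The invariant at the beginning of a slot, before delivery. Every block sent arrives in this slot
or in the next one. Chains of honest blocks arrive in this slot, and those of slots before the
preceding one have arrived. -/
structure Protocol.ReadyInv (P : Protocol.{u, v, w, s, t} Party Txs Hash AdvState)
    (N : GlobalState AdvState P.toChainParams) : Prop where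
  pend : ∀ b ∈ N.blockHistory, ∀ r, P.honest r = true → Pending N 2 r b
  slot_lt : ∀ b ∈ N.blockHistory, P.honest b.bid = true → b.slot < N.slot
  known : ∀ b ∈ N.blockHistory, P.honest b.bid = true → P.Known N (fun _ => 1) b
  settled : ∀ b ∈ N.blockHistory, P.honest b.bid = true → b.slot + 1 < N.slot →
    P.Known N (fun _ => 0) b

open scoped Classical in
/-- The invariant during delivery, when the parties in `A` have been activated and `H` is the
block history from the beginning of the slot. Only blocks of `H` are delivered, since what the
adversary sends now is not yet due. -/
structure Protocol.ReceivingInv (P : Protocol.{u, v, w, s, t} Party Txs Hash AdvState)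
    (H : List (Block Party Txs Hash)) (A : Set Party)
    (N : GlobalState AdvState P.toChainParams) : Prop where
  pend : ∀ b ∈ N.blockHistory, ∀ r, P.honest r = true → Pending N 3 r b
  pend_old : ∀ b ∈ H, ∀ r, P.honest r = true → Pending N 2 r b
  tree_old : ∀ q l, N.stateMap q = some l → ∀ b ∈ l.blocks, b ∈ H
  due_old : ∀ m ∈ N.msgBuff, m.cd = 0 → m.msg.block ∈ H
  slot_lt : ∀ b ∈ N.blockHistory, P.honest b.bid = true → b.slot < N.slot
  known : ∀ b ∈ N.blockHistory, P.honest b.bid = true →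
    P.Known N (fun r => if r ∈ A then 0 else 1) b

/-- The invariant after delivery, when the parties in `A` have been activated for baking. Every
block sent arrives within two slots, and what an honest party has seen arrives at the latest in the
next slot at all other honest parties. Chains of honest blocks of earlier slots have arrived. -/
structure Protocol.BakingInv (P : Protocol.{u, v, w, s, t} Party Txs Hash AdvState)
    (A : Set Party) (N : GlobalState AdvState P.toChainParams) : Prop where
  pend : ∀ b ∈ N.blockHistory, ∀ r, P.honest r = true → Pending N 3 r b
  seen : ∀ q l, P.honest q = true → N.stateMap q = some l → ∀ b ∈ l.blocks,
    ∀ r, P.honest r = true → Pending N 2 r b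
  settled : ∀ b ∈ N.blockHistory, P.honest b.bid = true → b.slot < N.slot →
    P.Known N (fun _ => 0) b
  known : ∀ b ∈ N.blockHistory, P.honest b.bid = true → P.Known N (fun _ => 2) b
  fresh : ∀ b ∈ N.blockHistory, P.honest b.bid = true → b.slot = N.slot → b.bid ∈ A
  baked : ∀ p ∈ P.initParties, p ∈ A → P.honest p = true → P.winner p N.slot = true →
    ∃ b ∈ N.blockHistory, b.bid = p ∧ b.slot = N.slot

section Invariants

variable {P : Protocol.{u, v, w, s, t} Party Txs Hash AdvState}
  {N : GlobalState AdvState P.toChainParams}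

lemma Protocol.Known.mono {N' : GlobalState AdvState P.toChainParams} {d d' : Party → ℕ}
    {b : Block Party Txs Hash}
    (h : ∀ r, P.honest r = true → ∀ x, Pending N (d r) r x → Pending N' (d' r) r x)
    (hk : P.Known N d b) : P.Known N' d' b := by
  obtain ⟨c, h1, h2, h3⟩ := hk
  exact ⟨c, h1, h2, fun r hr x hx => h r hr x (h3 r hr x hx)⟩

/-- The invariant of the block history depends on its honest blocks only. -/
lemma Protocol.HistInv.congr {S : Set (Block Party Txs Hash)}
    {N' : GlobalState AdvState P.toChainParams} (h : P.HistInv S N) (hs : N'.slot = N.slot)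
    (hb : ∀ b, P.honest b.bid = true → (b ∈ N'.blockHistory ↔ b ∈ N.blockHistory)) :
    P.HistInv S N' where
  slot_pos := hs ▸ h.slot_pos
  slot_le b hm hh := hs ▸ h.slot_le b ((hb b hh).1 hm) hh
  genesis_or b hm hh := h.genesis_or b ((hb b hh).1 hm) hh
  unique b hm b' hm' hh hbid hslot :=
    h.unique b ((hb b hh).1 hm) b' ((hb b' (hbid ▸ hh)).1 hm') hh hbid hslot
  exists_block p hp hh x hx hlt hw := by
    obtain ⟨b, h1, h2, h3⟩ := h.exists_block p hp hh x hx (hs ▸ hlt) hw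
    exact ⟨b, (hb b (h2 ▸ hh)).2 h1, h2, h3⟩
  growth b hm b' hm' hh hh' := h.growth b ((hb b hh).1 hm) b' ((hb b' hh').1 hm') hh hh'

lemma Protocol.HistInv.insert {S : Set (Block Party Txs Hash)}
    {N' : GlobalState AdvState P.toChainParams} (h : P.HistInv S N) (hs : N'.slot = N.slot)
    {b : Block Party Txs Hash} (hb : ∀ x, x ∈ N'.blockHistory ↔ x ∈ N.blockHistory ∨ x = b)
    (hslot : b.slot = N.slot) (hbid : b.bid ∈ P.initParties)
    (hfresh : ∀ x ∈ N.blockHistory, P.honest x.bid = true → x.bid = b.bid → x.slot ≠ b.slot)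
    (hgrowth : ∀ x ∈ N.blockHistory, P.honest x.bid = true → x.slot < b.slot →
      ∀ c c', P.ChainTo S x c → P.ChainTo S b c' → c.length < c'.length) :
    P.HistInv S N' where
  slot_pos := hs ▸ h.slot_pos
  slot_le x hm hh := by
    rcases (hb x).1 hm with hm | rfl
    · exact hs ▸ h.slot_le x hm hh
    · exact (hslot.trans hs.symm).le
  genesis_or x hm hh := by
    rcases (hb x).1 hm with hm | rfl
    · exact h.genesis_or x hm hh
    · exact .inr ⟨hslot ▸ h.slot_pos, hbid⟩
  unique x hx y hy hh h1 h2 := by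
    rcases (hb x).1 hx with hx | rfl <;> rcases (hb y).1 hy with hy | rfl
    · exact h.unique x hx y hy hh h1 h2
    · exact absurd h2 (hfresh x hx hh h1)
    · exact absurd h2.symm (hfresh y hy (h1 ▸ hh) h1.symm)
    · rfl
  exists_block p hp hh x hx hlt hw := by
    obtain ⟨y, h1, h2⟩ := h.exists_block p hp hh x hx (hs ▸ hlt) hw
    exact ⟨y, (hb y).2 (.inl h1), h2⟩
  growth x hx y hy hhx hhy hlt c c' hc hc' := by
    rcases (hb y).1 hy with hy | rfl
    · rcases (hb x).1 hx with hx | rfl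
      · exact h.growth x hx y hy hhx hhy hlt c c' hc hc'
      · have := h.slot_le y hy hhy
        lia
    · rcases (hb x).1 hx with hx | rfl
      · exact hgrowth x hx hhx hlt c c' hc hc'
      · exact absurd hlt (lt_irrefl _)

lemma Protocol.StateInv.mem_execOrder (h : P.StateInv N) {p : Party}
    {l : LocalState P.toChainParams} (hl : N.stateMap p = some l) : p ∈ N.execOrder :=
  h.perm.mem_iff.2 (h.mem_init p l hl)

lemma Protocol.StateInv.flood (h : P.StateInv N)
    (ms : List (Message Party Txs Hash × DelayMap Party)) : P.StateInv (floodMsgsAdv ms N) where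
  perm := h.perm
  mem_init := h.mem_init
  id_eq := h.id_eq
  exists_state := h.exists_state
  tree_sub p l hl b hb := mem_blockHistory_floodMsgsAdv.2 (.inl (h.tree_sub p l hl b hb))
  buff_sub m hm := by
    rcases mem_msgBuff_floodMsgsAdv.1 hm with hm | ⟨a, ha, q, hq, rfl⟩
    · exact mem_blockHistory_floodMsgsAdv.2 (.inl (h.buff_sub m hm))
    · exact mem_blockHistory_floodMsgsAdv.2 (.inr ⟨a, ha, rfl⟩)

lemma Protocol.StateInv.filter (h : P.StateInv N) (f : MsgTuple Party Txs Hash → Bool)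
    (a : AdvState) :
    P.StateInv { N with msgBuff := N.msgBuff.filter f, advState := a } where
  perm := h.perm
  mem_init := h.mem_init
  id_eq := h.id_eq
  exists_state := h.exists_state
  tree_sub := h.tree_sub
  buff_sub m hm := h.buff_sub m (List.mem_of_mem_filter hm)

lemma history_subset_foldl {f : GlobalState AdvState P.toChainParams → Party →
    GlobalState AdvState P.toChainParams} (hf : ∀ N p, N.history ⊆ (f N p).history)
    (o : List Party) (N : GlobalState AdvState P.toChainParams) :
    N.history ⊆ (o.foldl f N).history := by
  induction o generalizing N with
  | nil => exact List.Subset.refl _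
  | cons p o ih => exact List.Subset.trans (hf N p) (ih (f N p))

variable [DecidableEq Party]

lemma Protocol.StateInv.setState (h : P.StateInv N) {p : Party}
    {l : LocalState P.toChainParams} (hp : p ∈ P.initParties) (hid : l.id = p)
    (hl : ∀ b ∈ l.blocks, b ∈ N.blockHistory) : P.StateInv (N.setState p l) where
  perm := h.perm
  mem_init q l' hq := by
    by_cases hqp : q = p
    · exact hqp ▸ hp
    · exact h.mem_init q l' (by simpa [GlobalState.setState, hqp] using hq)
  id_eq q l' hq := by
    by_cases hqp : q = p
    · subst hqp
      obtain rfl : l = l' := by simpa [GlobalState.setState] using hq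
      exact hid
    · exact h.id_eq q l' (by simpa [GlobalState.setState, hqp] using hq)
  exists_state q hq := by
    by_cases hqp : q = p
    · exact ⟨l, by simp [GlobalState.setState, hqp]⟩
    · simpa [GlobalState.setState, hqp] using h.exists_state q hq
  tree_sub q l' hq := by
    by_cases hqp : q = p
    · subst hqp
      obtain rfl : l = l' := by simpa [GlobalState.setState] using hq
      exact hl
    · exact h.tree_sub q l' (by simpa [GlobalState.setState, hqp] using hq)
  buff_sub := h.buff_sub

lemma Pending.setState {p r : Party} {l l' : LocalState P.toChainParams}
    (hl : N.stateMap p = some l) (hsub : ∀ b ∈ l.blocks, b ∈ l'.blocks) {d : ℕ}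
    {b : Block Party Txs Hash} (h : Pending N d r b) : Pending (N.setState p l') d r b := by
  intro k hk
  by_cases hr : r = p
  · subst hr
    obtain rfl : l' = k := by simpa [GlobalState.setState] using hk
    exact (h l hl).imp_left (hsub b)
  · exact h k (by simpa [GlobalState.setState, hr] using hk)

/-! ### Delivery -/

lemma slot_rcvParty (p : Party) : (P.rcvParty N p).slot = N.slot := by
  unfold Protocol.rcvParty
  dsimp only
  split
  · split <;> rfl
  · rfl

lemma blockHistory_rcvParty_honest {p : Party} (hp : P.honest p = true) :
    (P.rcvParty N p).blockHistory = N.blockHistory := by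
  unfold Protocol.rcvParty
  rw [if_pos hp]
  split <;> rfl

/-- Without forgeries, an activation for delivery produces no new honest block. -/
lemma mem_blockHistory_rcvParty {p : Party}
    (hf : P.honest p = false → P.NoForgery N (P.advRcvOut N).1) {b : Block Party Txs Hash}
    (hb : P.honest b.bid = true) :
    b ∈ (P.rcvParty N p).blockHistory ↔ b ∈ N.blockHistory := by
  rcases hp : P.honest p with _ | _
  · rw [rcvParty_corrupt hp, mem_blockHistory_floodMsgsAdv]
    constructor
    · rintro (h | ⟨m, hm, rfl⟩)
      · exact h
      · exact hf hp m hm hb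
    · exact Or.inl
  · rw [blockHistory_rcvParty_honest hp]

lemma mem_blocks_rcv {p : Party} {l : LocalState P.toChainParams} {b : Block Party Txs Hash} :
    b ∈ (honestRcv ((N.msgBuff.filter (MsgTuple.dueFor p)).map MsgTuple.msg) l).blocks ↔
      b ∈ l.blocks ∨ ∃ m ∈ N.msgBuff, m.rcv = p ∧ m.cd = 0 ∧ m.msg.block = b := by
  simp [mem_blocks_honestRcv, MsgTuple.dueFor, and_assoc]

lemma Protocol.StateInv.rcvParty (h : P.StateInv N) {p : Party} (hp : p ∈ P.initParties) :
    P.StateInv (P.rcvParty N p) := by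
  rcases hh : P.honest p with _ | _
  · rw [rcvParty_corrupt hh]
    exact (h.filter _ _).flood _
  · obtain ⟨l, hl⟩ := h.exists_state p hp
    rw [rcvParty_honest hh hl]
    refine (h.filter _ N.advState).setState hp (h.id_eq p l hl) fun b hb => ?_
    rcases mem_blocks_rcv.1 hb with hb | ⟨m, hm, -, -, rfl⟩
    · exact h.tree_sub p l hl b hb
    · exact h.buff_sub m hm

lemma Pending.rcvParty (h : P.StateInv N) {p r : Party} (hp : p ∈ P.initParties)
    (hr : P.honest r = true) {d : ℕ} {b : Block Party Txs Hash} (hb : Pending N d r b) :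
    Pending (P.rcvParty N p) d r b := by
  rcases hh : P.honest p with _ | _
  · rw [rcvParty_corrupt hh]
    have hrp : r ≠ p := by
      rintro rfl
      simp [hr] at hh
    refine Pending.flood _ fun l hl => (hb l hl).imp_right ?_
    rintro ⟨m, hm, h1, h2⟩
    exact ⟨m, List.mem_filter.2 ⟨hm, by simp [MsgTuple.dueFor, h1, hrp]⟩, h1, h2⟩
  · obtain ⟨l, hl⟩ := h.exists_state p hp
    rw [rcvParty_honest hh hl]
    intro k hk
    by_cases hrp : r = p
    · subst hrp
      obtain rfl := by simpa [GlobalState.setState] using hk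
      rcases hb l hl with hb | ⟨m, hm, h1, h2, h3⟩
      · exact .inl (mem_blocks_rcv.2 (.inl hb))
      · by_cases h0 : m.cd = 0
        · exact .inl (mem_blocks_rcv.2 (.inr ⟨m, hm, h1, h0, h2⟩))
        · exact .inr ⟨m, List.mem_filter.2 ⟨hm, by simp [MsgTuple.dueFor, h0]⟩, h1, h2, h3⟩
    · refine (hb k (by simpa [GlobalState.setState, hrp] using hk)).imp_right ?_
      rintro ⟨m, hm, h1, h2⟩
      exact ⟨m, List.mem_filter.2 ⟨hm, by simp [MsgTuple.dueFor, h1, hrp]⟩, h1, h2⟩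

/-- The activation of an honest party delivers everything that is due for it. -/
lemma Pending.rcvParty_self {p : Party} (hh : P.honest p = true) {b : Block Party Txs Hash}
    (hb : Pending N 1 p b) : Pending (P.rcvParty N p) 0 p b := by
  rcases hl : N.stateMap p with _ | l
  · intro k hk
    simp [Protocol.rcvParty, hh, hl] at hk
  · rw [rcvParty_honest hh hl]
    intro k hk
    obtain rfl := by simpa [GlobalState.setState] using hk
    refine .inl (mem_blocks_rcv.2 ((hb l hl).imp_right ?_))
    rintro ⟨m, hm, h1, h2, h3⟩
    exact ⟨m, hm, h1, by omega, h2⟩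

lemma Protocol.ReceivingInv.rcvParty {H : List (Block Party Txs Hash)} {A : Set Party}
    (h : P.ReceivingInv H A N) (hs : P.StateInv N) {p : Party} (hp : p ∈ P.initParties)
    (hf : P.honest p = false → P.NoForgery N (P.advRcvOut N).1) :
    P.ReceivingInv H (insert p A) (P.rcvParty N p) where
  pend b hb r hr := by
    by_cases hold : b ∈ N.blockHistory
    · exact (h.pend b hold r hr).rcvParty hs hp hr
    · rcases hh : P.honest p with _ | _
      · rw [rcvParty_corrupt hh] at hb ⊢
        rcases mem_blockHistory_floodMsgsAdv.1 hb with hb | ⟨a, ha, rfl⟩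
        · exact absurd hb hold
        · exact pending_floodMsgsAdv ha (fun l hl => hs.mem_execOrder hl)
            (Nat.lt_succ_of_le (a.2 r).toNat_le_two)
      · rw [blockHistory_rcvParty_honest hh] at hb
        exact absurd hb hold
  pend_old b hb r hr := (h.pend_old b hb r hr).rcvParty hs hp hr
  tree_old q l hl b hb := by
    rcases hh : P.honest p with _ | _
    · rw [rcvParty_corrupt hh] at hl
      exact h.tree_old q l hl b hb
    · obtain ⟨k, hk⟩ := hs.exists_state p hp
      rw [rcvParty_honest hh hk] at hl
      by_cases hqp : q = p
      · subst hqp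
        obtain rfl := by simpa [GlobalState.setState] using hl
        rcases mem_blocks_rcv.1 hb with hb | ⟨m, hm, -, h0, rfl⟩
        · exact h.tree_old q k hk b hb
        · exact h.due_old m hm h0
      · exact h.tree_old q l (by simpa [GlobalState.setState, hqp] using hl) b hb
  due_old m hm h0 := by
    rcases hh : P.honest p with _ | _
    · rw [rcvParty_corrupt hh] at hm
      rcases mem_msgBuff_floodMsgsAdv.1 hm with hm | ⟨a, ha, q, hq, rfl⟩
      · exact h.due_old m (List.mem_of_mem_filter hm) h0
      · have := (a.2 q).one_le_toNat
        simp only at h0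
        omega
    · obtain ⟨k, hk⟩ := hs.exists_state p hp
      rw [rcvParty_honest hh hk] at hm
      exact h.due_old m (List.mem_of_mem_filter hm) h0
  slot_lt b hb hh := by
    rw [slot_rcvParty]
    exact h.slot_lt b ((mem_blockHistory_rcvParty hf hh).1 hb) hh
  known b hb hh := by
    refine (h.known b ((mem_blockHistory_rcvParty hf hh).1 hb) hh).mono fun r hr x hx => ?_
    by_cases hrA : r ∈ A
    · simp only [hrA, Set.mem_insert_iff, or_true, if_true] at hx ⊢
      exact hx.rcvParty hs hp hr
    · by_cases hrp : r = p
      · subst hrp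
        simp only [hrA, Set.mem_insert_iff, true_or, if_true, if_false] at hx ⊢
        exact hx.rcvParty_self hr
      · simp only [hrA, hrp, Set.mem_insert_iff, false_or, if_false] at hx ⊢
        exact hx.rcvParty hs hp hr

/-- Induction over the activations in a fold over `o`: the property may depend on the elements
processed so far. -/
lemma foldl_induction {α β : Type*} (f : β → α → β) (o : List α) (a : β)
    {Q : List α → β → Prop} (h0 : Q [] a)
    (hs : ∀ xs p ys, o = xs ++ p :: ys → Q xs (xs.foldl f a) →
      Q (xs ++ [p]) (f (xs.foldl f a) p)) : Q o (o.foldl f a) := by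
  suffices h : ∀ xs ys, o = xs ++ ys → Q xs (xs.foldl f a) from h o [] (by simp)
  intro xs
  induction xs using List.reverseRecOn with
  | nil => exact fun _ _ => h0
  | append_singleton xs p ih =>
    intro ys ho
    rw [List.foldl_append]
    exact hs xs p ys (by simpa using ho) (ih (p :: ys) (by simpa using ho))

/-- The delivery step leads from the invariant at the beginning of a slot to the invariant
before baking. -/
lemma receive_inv {S : Set (Block Party Txs Hash)} (hs : P.StateInv N) (hh : P.HistInv S N)
    (hr : P.ReadyInv N)
    (hf : ∀ xs p ys, N.execOrder = xs ++ p :: ys → P.honest p = false →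
      P.NoForgery (xs.foldl P.rcvParty N) (P.advRcvOut (xs.foldl P.rcvParty N)).1) :
    P.StateInv (P.receive N) ∧ P.HistInv S (P.receive N) ∧ P.BakingInv ∅ (P.receive N) := by
  set M := N.execOrder.foldl P.rcvParty N
  obtain ⟨h1, h2, h3⟩ : P.StateInv M ∧ P.HistInv S M ∧
      P.ReceivingInv N.blockHistory {p | p ∈ N.execOrder} M := by
    refine foldl_induction P.rcvParty N.execOrder N (Q := fun xs M => P.StateInv M ∧
      P.HistInv S M ∧ P.ReceivingInv N.blockHistory {p | p ∈ xs} M) ⟨hs, hh, ?_⟩ ?_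
    · exact {
        pend := fun b hb r hr' => (hr.pend b hb r hr').mono (by omega)
        pend_old := hr.pend
        tree_old := hs.tree_sub
        due_old := fun m hm _ => hs.buff_sub m hm
        slot_lt := hr.slot_lt
        known := fun b hb hb' => by simpa using hr.known b hb hb' }
    · rintro xs p ys ho ⟨h1, h2, h3⟩
      have hp : p ∈ P.initParties := hs.perm.mem_iff.1 (by simp [ho])
      have hset : {q | q ∈ xs ++ [p]} = insert p {q | q ∈ xs} := by
        ext q
        simp [or_comm]
      rw [hset]
      exact ⟨h1.rcvParty hp,
        h2.congr (slot_rcvParty p) fun b hb => mem_blockHistory_rcvParty (hf xs p ys ho) hb,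
        h3.rcvParty h1 hp (hf xs p ys ho)⟩
  have hk : ∀ b ∈ M.blockHistory, P.honest b.bid = true → P.Known M (fun _ => 0) b := by
    refine fun b hb hb' => (h3.known b hb hb').mono fun r _ x hx l hl => ?_
    have : r ∈ N.execOrder := hs.perm.mem_iff.2 (h1.mem_init r l hl)
    simp only [Set.mem_ofPred_eq, this, if_true] at hx
    exact hx l hl
  refine ⟨⟨h1.perm, h1.mem_init, h1.id_eq, h1.exists_state, h1.tree_sub, h1.buff_sub⟩,
    ⟨h2.slot_pos, h2.slot_le, h2.genesis_or, h2.unique, h2.exists_block, h2.growth⟩, ?_⟩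
  exact {
    pend := h3.pend
    seen := fun q l _ hl b hb => h3.pend_old b (h3.tree_old q l hl b hb)
    settled := fun b hb hb' _ => hk b hb hb'
    known := fun b hb hb' => (hk b hb hb').mono fun r _ x hx => Pending.mono (by omega) hx
    fresh := fun b hb hb' hslot => absurd (h3.slot_lt b hb hb') hslot.not_lt
    baked := fun p _ hp => hp.elim }

/-! ### Baking -/

/-- The activation of an honest winner `p` for baking. Its new block is higher than all honest
blocks of earlier slots, because their chains are in the tree of `p`. -/
lemma bakeParty_winner_inv {S : Set (Block Party Txs Hash)} {A : Set Party} {p : Party}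
    (hg : P.genesis.slot = 0) (hS : P.HashInjOn S) (hs : P.StateInv N) (hi : P.HistInv S N)
    (hb : P.BakingInv A N) (hpA : p ∉ A) (hsub : ∀ b ∈ (P.bakeParty N p).blockHistory, b ∈ S)
    (hp : P.honest p = true) {l : LocalState P.toChainParams} (hl : N.stateMap p = some l)
    (hw : P.winner p N.slot = true) :
    P.StateInv (P.bakeParty N p) ∧ P.HistInv S (P.bakeParty N p) ∧
      P.BakingInv (insert p A) (P.bakeParty N p) := by
  have hid : l.id = p := hs.id_eq p l hl
  rw [bakeParty_honest_winner hp hl (by rwa [hid])] at hsub ⊢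
  set b := bakedBlock N.slot (P.txSelection N.slot p) l
  have hbslot : b.slot = N.slot := rfl
  have hbbid : b.bid = p := hid
  set F := floodMsgsAdv [(Message.blockMsg b, fun _ => Delay.one)] N with hF
  set N' := F.setState p (l.insert b) with hN'
  have hbh : ∀ x, x ∈ N'.blockHistory ↔ x ∈ N.blockHistory ∨ x = b := by
    intro x
    have : x ∈ N'.blockHistory ↔ x ∈ F.blockHistory := Iff.rfl
    rw [this, hF, mem_blockHistory_floodMsgsAdv]
    simp [Message.block, eq_comm]
  have hlF : F.stateMap p = some l := hl
  have hpend : ∀ {d r x}, Pending N d r x → Pending N' d r x := fun h =>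
    (h.flood _ : Pending F _ _ _).setState hlF fun x hx => LocalState.mem_blocks_insert.2 (.inl hx)
  have hpendb : ∀ r, Pending N' 2 r b := fun r => by
    have : Pending F 2 r b :=
      pending_floodMsgsAdv (a := (Message.blockMsg b, fun _ => Delay.one))
        (List.mem_singleton_self _) (fun k hk => hs.mem_execOrder hk) Nat.one_lt_two
    exact this.setState hlF fun x hx => LocalState.mem_blocks_insert.2 (.inl hx)
  have hfresh : ∀ x ∈ N.blockHistory, P.honest x.bid = true → x.bid = b.bid →
      x.slot ≠ b.slot := fun x hx hxh hxb hslot =>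
    hpA (hbbid ▸ hxb ▸ hb.fresh x hx hxh (hslot.trans hbslot))
  have hbest : P.ValidChain (l.best (N.slot - 1)) := l.tT.valid _ _
  have hbest_mem : ∀ x ∈ l.best (N.slot - 1), x ∈ l.blocks ∧ x.slot ≤ N.slot - 1 :=
    l.tT.selfContained _ _
  have hchain : P.ValidChain (b :: l.best (N.slot - 1)) := by
    refine hbest.cons ?_ rfl fun x hx => ?_
    · change P.winner b.bid b.slot = true
      rw [hbbid]
      exact hw
    · have h1 := (hbest_mem x hx).2
      have h2 := hi.slot_pos
      lia
  refine ⟨?_, ?_, ?_⟩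
  · refine (hs.flood _).setState (hs.mem_init p l hl) hid fun x hx => (hbh x).2 ?_
    exact (LocalState.mem_blocks_insert.1 hx).imp_left (hs.tree_sub p l hl x)
  · refine hi.insert rfl hbh hbslot (hbbid ▸ hs.mem_init p l hl) hfresh ?_
    intro x hx hxh hlt c c' hc hc'
    obtain ⟨c₀, h1, h2, h3⟩ := hb.settled x hx hxh (hbslot ▸ hlt)
    have htree : ∀ y ∈ c₀, y ∈ l.blocks := fun y hy => (h3 p hp y hy).mem hl
    have htreeS : ∀ y ∈ l.blocks, y ∈ S := fun y hy =>
      hsub y ((hbh y).2 (.inl (hs.tree_sub p l hl y hy)))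
    obtain rfl : c = c₀ := hc.unique hg hS ⟨h1, fun y hy => htreeS y (htree y hy), h2⟩
    obtain rfl : c' = b :: l.best (N.slot - 1) := hc'.unique hg hS ⟨hchain, fun y hy => by
      rcases List.mem_cons.1 hy with rfl | hy
      · exact hsub b ((hbh b).2 (.inr rfl))
      · exact htreeS y (hbest_mem y hy).1, rfl⟩
    have : c.length ≤ (l.best (N.slot - 1)).length := by
      refine l.tT.optimal c l.tree (N.slot - 1) h1 fun y hy => ⟨htree y hy, ?_⟩
      have := h1.slot_le_of_head h2 hy
      lia
    rw [List.length_cons]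
    omega
  · exact {
      pend := fun x hx r hr => by
        rcases (hbh x).1 hx with hx | rfl
        · exact hpend (hb.pend x hx r hr)
        · exact (hpendb r).mono (by omega)
      seen := fun q k hq hk x hx r hr => by
        by_cases hqp : q = p
        · subst hqp
          obtain rfl : l.insert b = k := by simpa [hN', GlobalState.setState] using hk
          rcases LocalState.mem_blocks_insert.1 hx with hx | rfl
          · exact hpend (hb.seen q l hq hl x hx r hr)
          · exact hpendb r
        · have hk : N.stateMap q = some k := by
            simpa [hN', hF, floodMsgsAdv, GlobalState.setState, hqp] using hk
          exact hpend (hb.seen q k hq hk x hx r hr)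
      settled := fun x hx hxh hlt => by
        rcases (hbh x).1 hx with hx | rfl
        · exact (hb.settled x hx hxh hlt).mono fun r _ y hy => hpend hy
        · exact absurd hlt (lt_irrefl _)
      known := fun x hx hxh => by
        rcases (hbh x).1 hx with hx | rfl
        · exact (hb.known x hx hxh).mono fun r _ y hy => hpend hy
        · refine ⟨_, hchain, rfl, fun r hr y hy => ?_⟩
          rcases List.mem_cons.1 hy with rfl | hy
          · exact hpendb r
          · exact hpend (hb.seen p l hp hl y (hbest_mem y hy).1 r hr)
      fresh := fun x hx hxh hslot => by
        rcases (hbh x).1 hx with hx | rfl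
        · exact .inr (hb.fresh x hx hxh hslot)
        · exact .inl hbbid
      baked := fun q hq hqA hqh hqw => by
        rcases hqA with rfl | hqA
        · exact ⟨b, (hbh b).2 (.inr rfl), hbbid, rfl⟩
        · obtain ⟨x, h1, h2⟩ := hb.baked q hq hqA hqh hqw
          exact ⟨x, (hbh x).2 (.inl h1), h2⟩ }

lemma bakeParty_loser_inv {S : Set (Block Party Txs Hash)} {A : Set Party} {p : Party}
    (hs : P.StateInv N) (hi : P.HistInv S N) (hb : P.BakingInv A N) (hp : P.honest p = true)
    {l : LocalState P.toChainParams} (hl : N.stateMap p = some l)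
    (hw : ¬ P.winner p N.slot = true) :
    P.StateInv (P.bakeParty N p) ∧ P.HistInv S (P.bakeParty N p) ∧
      P.BakingInv (insert p A) (P.bakeParty N p) := by
  rw [bakeParty_honest_loser hp hl (by rwa [hs.id_eq p l hl])]
  refine ⟨hs, hi, hb.pend, hb.seen, hb.settled, hb.known,
    fun x hx hxh hslot => .inr (hb.fresh x hx hxh hslot), fun q hq hqA hqh hqw => ?_⟩
  rcases hqA with rfl | hqA
  · exact absurd hqw hw
  · exact hb.baked q hq hqA hqh hqw

lemma bakeParty_corrupt_inv {S : Set (Block Party Txs Hash)} {A : Set Party} {p : Party}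
    (hs : P.StateInv N) (hi : P.HistInv S N) (hb : P.BakingInv A N) (hp : P.honest p = false)
    (hf : P.NoForgery N (P.advBakeOut N).1) :
    P.StateInv (P.bakeParty N p) ∧ P.HistInv S (P.bakeParty N p) ∧
      P.BakingInv (insert p A) (P.bakeParty N p) := by
  rw [bakeParty_corrupt hp]
  set N' := floodMsgsAdv (P.advBakeOut N).1 { N with advState := (P.advBakeOut N).2 } with hN'
  have hmem : ∀ x, P.honest x.bid = true → (x ∈ N'.blockHistory ↔ x ∈ N.blockHistory) := by
    intro x hx
    rw [hN', mem_blockHistory_floodMsgsAdv]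
    constructor
    · rintro (h | ⟨m, hm, rfl⟩)
      · exact h
      · exact hf m hm hx
    · exact Or.inl
  have hs' : P.StateInv { N with advState := (P.advBakeOut N).2 } :=
    ⟨hs.perm, hs.mem_init, hs.id_eq, hs.exists_state, hs.tree_sub, hs.buff_sub⟩
  have hpend : ∀ {d r x}, Pending N d r x → Pending N' d r x := fun h =>
    Pending.flood (N := { N with advState := (P.advBakeOut N).2 }) _ h
  refine ⟨hs'.flood _, hi.congr rfl hmem, ?_⟩
  exact {
    pend := fun x hx r hr => by
      rcases mem_blockHistory_floodMsgsAdv.1 hx with hx | ⟨a, ha, rfl⟩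
      · exact hpend (hb.pend x hx r hr)
      · exact pending_floodMsgsAdv ha (fun l hl => hs.mem_execOrder hl)
          (Nat.lt_succ_of_le (a.2 r).toNat_le_two)
    seen := fun q l hq hl x hx r hr => hpend (hb.seen q l hq hl x hx r hr)
    settled := fun x hx hxh hlt =>
      (hb.settled x ((hmem x hxh).1 hx) hxh hlt).mono fun r _ y hy => hpend hy
    known := fun x hx hxh =>
      (hb.known x ((hmem x hxh).1 hx) hxh).mono fun r _ y hy => hpend hy
    fresh := fun x hx hxh hslot => .inr (hb.fresh x ((hmem x hxh).1 hx) hxh hslot)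
    baked := fun q hq hqA hqh hqw => by
      rcases hqA with rfl | hqA
      · simp [hp] at hqh
      · obtain ⟨x, h1, h2⟩ := hb.baked q hq hqA hqh hqw
        exact ⟨x, (hmem x (h2.1 ▸ hqh)).2 h1, h2⟩ }

lemma bake_inv {S : Set (Block Party Txs Hash)} (hg : P.genesis.slot = 0)
    (hnodup : P.initParties.Nodup) (hS : P.HashInjOn S) (hs : P.StateInv N) (hi : P.HistInv S N)
    (hb : P.BakingInv ∅ N) (hsub : ∀ b ∈ (P.bake N).blockHistory, b ∈ S)
    (hf : ∀ xs p ys, N.execOrder = xs ++ p :: ys → P.honest p = false →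
      P.NoForgery (xs.foldl P.bakeParty N) (P.advBakeOut (xs.foldl P.bakeParty N)).1) :
    P.StateInv (P.bake N) ∧ P.HistInv S (P.bake N) ∧
      P.BakingInv {p | p ∈ P.initParties} (P.bake N) := by
  set M := N.execOrder.foldl P.bakeParty N
  obtain ⟨h1, h2, h3⟩ : P.StateInv M ∧ P.HistInv S M ∧
      P.BakingInv {p | p ∈ N.execOrder} M := by
    refine foldl_induction P.bakeParty N.execOrder N (Q := fun xs M => P.StateInv M ∧
      P.HistInv S M ∧ P.BakingInv {p | p ∈ xs} M) ⟨hs, hi, by simpa using hb⟩ ?_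
    rintro xs p ys ho ⟨h1, h2, h3⟩
    have hp : p ∈ P.initParties := hs.perm.mem_iff.1 (by simp [ho])
    have hset : {q | q ∈ xs ++ [p]} = insert p {q | q ∈ xs} := by
      ext q
      simp [or_comm]
    have hpxs : p ∉ {q | q ∈ xs} := by
      have hnd : (xs ++ p :: ys).Nodup := ho ▸ hs.perm.nodup_iff.2 hnodup
      exact fun hmem => (List.nodup_append.1 hnd).2.2 p hmem p (by simp) rfl
    have hsubp : ∀ b ∈ (P.bakeParty (xs.foldl P.bakeParty N) p).blockHistory, b ∈ S := by
      refine fun b hb => hsub b (blockHistory_mono ?_ hb)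
      have := history_subset_foldl history_subset_bakeParty ys
        (P.bakeParty (xs.foldl P.bakeParty N) p)
      rw [← List.foldl_cons, ← List.foldl_append, ← ho] at this
      exact this
    rw [hset]
    rcases hh : P.honest p with _ | _
    · exact bakeParty_corrupt_inv h1 h2 h3 hh (hf xs p ys ho hh)
    · obtain ⟨l, hl⟩ := h1.exists_state p hp
      by_cases hw : P.winner p (xs.foldl P.bakeParty N).slot = true
      · exact bakeParty_winner_inv hg hS h1 h2 h3 hpxs hsubp hh hl hw
      · exact bakeParty_loser_inv h1 h2 h3 hh hl hw
  have hset : {p | p ∈ N.execOrder} = {p | p ∈ P.initParties} := by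
    ext p
    exact hs.perm.mem_iff
  rw [hset] at h3
  exact ⟨⟨h1.perm, h1.mem_init, h1.id_eq, h1.exists_state, h1.tree_sub, h1.buff_sub⟩,
    ⟨h2.slot_pos, h2.slot_le, h2.genesis_or, h2.unique, h2.exists_block, h2.growth⟩,
    ⟨h3.pend, h3.seen, h3.settled, h3.known, h3.fresh, h3.baked⟩⟩

end Invariants

/-! ### Executions -/

section Executions

variable {P : Protocol.{u, v, w, s, t} Party Txs Hash AdvState}
  {N : GlobalState AdvState P.toChainParams}

/-- The invariant of all reachable states, with heights measured in `S`. -/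
structure Protocol.Inv (P : Protocol.{u, v, w, s, t} Party Txs Hash AdvState)
    (S : Set (Block Party Txs Hash)) (N : GlobalState AdvState P.toChainParams) : Prop where
  state : P.StateInv N
  hist : P.HistInv S N
  ready : N.progress = .ready → P.ReadyInv N
  delivered : N.progress = .delivered → P.BakingInv ∅ N
  baked : N.progress = .baked → P.BakingInv {p | p ∈ P.initParties} N

/-- Permutations of the buffer and of the execution order do not affect the invariant. -/
lemma Protocol.Inv.congr {S : Set (Block Party Txs Hash)} (h : P.Inv S N)
    {o : List Party} {ms : List (MsgTuple Party Txs Hash)} (ho : N.execOrder.Perm o)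
    (hms : N.msgBuff.Perm ms) : P.Inv S { N with execOrder := o, msgBuff := ms } := by
  set N' : GlobalState AdvState P.toChainParams := { N with execOrder := o, msgBuff := ms }
  have hpend : ∀ {d r x}, Pending N d r x → Pending N' d r x := fun hx l hl =>
    (hx l hl).imp_right fun ⟨m, hm, hm'⟩ => ⟨m, hms.mem_iff.1 hm, hm'⟩
  have hknown : ∀ {d x}, P.Known N d x → P.Known N' d x := fun hx =>
    hx.mono fun _ _ _ => hpend
  obtain ⟨h1, h2, h3, h4, h5⟩ := h
  have hbake : ∀ {A}, P.BakingInv A N → P.BakingInv A N' := fun h =>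
    ⟨fun b hb r hr => hpend (h.pend b hb r hr),
      fun q l hq hl b hb r hr => hpend (h.seen q l hq hl b hb r hr),
      fun b hb hb' hlt => hknown (h.settled b hb hb' hlt),
      fun b hb hb' => hknown (h.known b hb hb'), h.fresh, h.baked⟩
  refine ⟨⟨ho.symm.trans h1.perm, h1.mem_init, h1.id_eq, h1.exists_state, h1.tree_sub,
      fun m hm => h1.buff_sub m (hms.mem_iff.2 hm)⟩,
    ⟨h2.slot_pos, h2.slot_le, h2.genesis_or, h2.unique, h2.exists_block, h2.growth⟩,
    fun hp => ?_, fun hp => hbake (h4 hp), fun hp => hbake (h5 hp)⟩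
  have h := h3 hp
  exact ⟨fun b hb r hr => hpend (h.pend b hb r hr), h.slot_lt,
    fun b hb hb' => hknown (h.known b hb hb'),
    fun b hb hb' hlt => hknown (h.settled b hb hb' hlt)⟩

lemma increment_inv {S : Set (Block Party Txs Hash)} (hs : P.StateInv N) (hi : P.HistInv S N)
    (hb : P.BakingInv {p | p ∈ P.initParties} N) :
    P.StateInv (increment N) ∧ P.HistInv S (increment N) ∧ P.ReadyInv (increment N) := by
  refine ⟨⟨hs.perm, hs.mem_init, hs.id_eq, hs.exists_state, hs.tree_sub, fun m hm => ?_⟩,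
    ⟨Nat.le_succ_of_le hi.slot_pos, fun b hb hb' => Nat.le_succ_of_le (hi.slot_le b hb hb'),
      hi.genesis_or, hi.unique, fun p hp hh x hx hlt hw => ?_, hi.growth⟩,
    fun b hb' r hr => (hb.pend b hb' r hr).increment,
    fun b hb hb' => Nat.lt_succ_of_le (hi.slot_le b hb hb'),
    fun b hb' hh => (hb.known b hb' hh).mono fun r _ x hx => hx.increment,
    fun b hb' hh hlt => ?_⟩
  · obtain ⟨m', hm', rfl⟩ := List.mem_map.1 hm
    exact hs.buff_sub m' hm'
  · rcases Nat.lt_succ_iff_lt_or_eq.1 hlt with hlt | rfl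
    · exact hi.exists_block p hp hh x hx hlt hw
    · exact hb.baked p hp hp hh hw
  · exact (hb.settled b hb' hh (Nat.lt_of_succ_lt_succ hlt)).mono 
      fun r _ x (hx : Pending N 0 r x) l hl => .inl (hx.mem (l := l) hl)

variable [DecidableEq Party]

lemma init_inv {S : Set (Block Party Txs Hash)} (hg : P.genesis.slot = 0) :
    P.Inv S P.init := by
  have hst : ∀ {p l}, P.init.stateMap p = some l → p ∈ P.initParties ∧
      (⟨p, P.treeTypeMap p, (P.treeTypeMap p).tree0⟩ : LocalState P.toChainParams) = l := by
    intro p l hl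
    simpa [Protocol.init] using hl
  have hbh : ∀ {b}, b ∈ P.init.blockHistory → b = P.genesis := by
    intro b hb
    simpa [GlobalState.blockHistory, Protocol.init] using hb
  have hblocks : ∀ {p l}, P.init.stateMap p = some l → ∀ b, b ∈ l.blocks ↔ b = P.genesis := by
    intro p l hl b
    rw [← (hst hl).2]
    exact ((P.treeTypeMap p).instantiated b).trans List.mem_singleton
  -- The best chain of any initial tree shows that the genesis block is a valid block.
  have hvalid : P.ValidChain [P.genesis] := by
    have h := (P.treeTypeMap P.genesis.bid).valid (P.treeTypeMap P.genesis.bid).tree0 0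
    refine ⟨fun b hb => ?_, rfl, by simp⟩
    rw [List.mem_singleton.1 hb]
    exact h.1 _ h.genesis_mem
  have hpend : ∀ d r, Pending P.init d r P.genesis := fun d r l hl =>
    .inl ((hblocks hl _).2 rfl)
  refine ⟨⟨List.Perm.refl _, fun p l hl => (hst hl).1, fun p l hl => (hst hl).2 ▸ rfl,
    fun p hp => ⟨_, if_pos hp⟩, fun p l hl b hb => ?_, fun m hm => ?_⟩,
    ⟨le_rfl, fun b hb _ => ?_, fun b hb _ => .inl (hbh hb),
      fun b hb b' hb' _ _ _ => (hbh hb).trans (hbh hb').symm,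
      fun p _ _ x hx hlt => absurd hlt (not_lt.2 hx), fun b hb b' hb' _ _ hlt => ?_⟩,
    fun _ => ⟨fun b hb r _ => ?_, fun b hb _ => ?_, fun b hb _ => ?_, fun b hb _ hlt => ?_⟩,
    (fun h => nomatch h), (fun h => nomatch h)⟩
  · exact mem_blockHistory.2 (.inl ((hblocks hl b).1 hb))
  · simp [Protocol.init] at hm
  · rw [hbh hb, hg]
    exact Nat.zero_le _
  · rw [hbh hb, hbh hb'] at hlt
    exact absurd hlt (lt_irrefl _)
  · rw [hbh hb]
    exact hpend _ _
  · rw [hbh hb, hg]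
    exact Nat.one_pos
  · rw [hbh hb]
    refine ⟨_, hvalid, rfl, fun r _ x hx => ?_⟩
    rw [List.mem_singleton.1 hx]
    exact hpend _ _
  · exact absurd hlt (not_lt.2 (Nat.le_add_left 1 _))

lemma Protocol.Step.history_subset {N' : GlobalState AdvState P.toChainParams}
    (h : P.Step N N') : N.history ⊆ N'.history := by
  cases h with
  | receive => exact history_subset_foldl history_subset_rcvParty N.execOrder N
  | bake => exact history_subset_foldl history_subset_bakeParty N.execOrder N
  | increment => exact List.Subset.refl _
  | permExec => exact List.Subset.refl _
  | permBuff => exact List.Subset.refl _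

lemma Protocol.Reachable.blockHistory_subset {N' : GlobalState AdvState P.toChainParams}
    (h : P.Reachable N N') : N.blockHistory ⊆ N'.blockHistory := by
  induction h with
  | refl => exact List.Subset.refl _
  | tail _ hs ih => exact List.Subset.trans ih (blockHistory_mono hs.history_subset)

/-- All states on an execution that ends in a forging-free and collision-free state `F` satisfy
the invariant, with heights measured in the block history of `F`. -/
lemma inv_of_reachable {F : GlobalState AdvState P.toChainParams} (hg : P.genesis.slot = 0)
    (hnodup : P.initParties.Nodup) (hff : P.ForgingFree F) (hcf : CollisionFree F)
    (h : P.Reachable P.init N) (hF : P.Reachable N F) :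
    P.Inv {b | b ∈ F.blockHistory} N := by
  induction h with
  | refl => exact init_inv hg
  | @tail N N' hN hstep ih =>
    have hi := ih (.head hstep hF)
    cases hstep with
    | receive hp =>
      obtain ⟨h1, h2, h3⟩ := receive_inv hi.state hi.hist (hi.ready hp)
        fun xs p ys ho hc => (hff N hN xs p ys ho hc).1 hp hF
      exact ⟨h1, h2, (fun h => nomatch h), fun _ => h3, (fun h => nomatch h)⟩
    | bake hp =>
      obtain ⟨h1, h2, h3⟩ := bake_inv hg hnodup hcf hi.state hi.hist (hi.delivered hp)
        (fun b hb => hF.blockHistory_subset hb)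
        fun xs p ys ho hc => (hff N hN xs p ys ho hc).2 hp hF
      exact ⟨h1, h2, (fun h => nomatch h), (fun h => nomatch h), fun _ => h3⟩
    | increment hp =>
      obtain ⟨h1, h2, h3⟩ := increment_inv hi.state hi.hist (hi.baked hp)
      exact ⟨h1, h2, fun _ => h3, (fun h => nomatch h), (fun h => nomatch h)⟩
    | permExec o ho => exact hi.congr ho (List.Perm.refl _)
    | permBuff ms hms => exact hi.congr (List.Perm.refl _) hms

end Executions

/-! ### Common prefix -/

section CommonPrefix

variable {P : Protocol.{u, v, w, s, t} Party Txs Hash AdvState}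
  {N : GlobalState AdvState P.toChainParams}

/-- The block `b` has height `n`: it is the newest block of a valid chain of length `n` within
`S`. The height is unique if the hash function is injective on `S`. -/
def ChainParams.HasHeight (P : ChainParams Party Txs Hash) (S : Set (Block Party Txs Hash))
    (b : Block Party Txs Hash) (n : ℕ) : Prop :=
  ∃ c, P.ChainTo S b c ∧ c.length = n

lemma Protocol.Inv.settled {S : Set (Block Party Txs Hash)} (h : P.Inv S N)
    {b : Block Party Txs Hash} (hb : b ∈ N.blockHistory) (hh : P.honest b.bid = true)
    (hlt : b.slot + 1 < N.slot) : P.Known N (fun _ => 0) b := by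
  rcases hp : N.progress with _ | _ | _
  · exact (h.ready hp).settled b hb hh hlt
  · exact (h.delivered hp).settled b hb hh (by lia)
  · exact (h.baked hp).settled b hb hh (by lia)

/-- Chain growth: a super slot that is over for at least one further slot has an honest block, and
the best chain of every honest party has at least the height of this block. -/
lemma Protocol.Inv.exists_height (hi : P.Inv {b | b ∈ N.blockHistory} N) {x : Slot}
    (hx : P.SuperSlot x) (hx1 : 1 ≤ x) (hxN : x < N.slot - 1) :
    ∃ b ∈ N.blockHistory, P.honest b.bid = true ∧ b.slot = x ∧
      ∃ n, P.HasHeight {b | b ∈ N.blockHistory} b n ∧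
        ∀ p l, P.honest p = true → N.stateMap p = some l →
          n ≤ (l.best (N.slot - 1)).length := by
  obtain ⟨q, ⟨hq, hw, hqh⟩, -⟩ := hx
  obtain ⟨b, hb, rfl, rfl⟩ := hi.hist.exists_block q hq hqh x hx1 (by lia) hw
  obtain ⟨c, h1, h2, h3⟩ := hi.settled hb hqh (by lia)
  obtain ⟨k, hk⟩ := hi.state.exists_state b.bid hq
  refine ⟨b, hb, hqh, rfl, c.length, ⟨c, ⟨h1, fun y hy =>
    hi.state.tree_sub b.bid k hk y ((h3 b.bid hqh y hy).mem hk), h2⟩, rfl⟩, fun p l hp hl => ?_⟩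
  refine l.tT.optimal c l.tree _ h1 fun y hy => ⟨(h3 p hp y hy).mem hl, ?_⟩
  have := h1.slot_le_of_head h2 hy
  lia

/-- There is a corrupted block of slot `s` in `c` whose height in `c` is also the height of an
honest block of slot `x`. -/
def Protocol.CorruptAt (P : Protocol.{u, v, w, s, t} Party Txs Hash AdvState)
    (S : Set (Block Party Txs Hash)) (c : Chain Party Txs Hash) (x s : Slot) : Prop :=
  ∃ b ∈ S, P.honest b.bid = true ∧ b.slot = x ∧
    ∃ y t, y :: t <:+ c ∧ P.honest y.bid = false ∧ y.slot = s ∧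
      P.HasHeight S b (y :: t).length

/-- The adversary uses a different slot for each block of a chain. -/
lemma card_corruptAt_le {S : Set (Block Party Txs Hash)} {c : Chain Party Txs Hash}
    (hg : P.genesis.slot = 0) (hS : P.HashInjOn S)
    (hgrowth : ∀ b ∈ S, ∀ b' ∈ S, P.honest b.bid = true → P.honest b'.bid = true →
      b.slot < b'.slot → ∀ c c', P.ChainTo S b c → P.ChainTo S b' c' → c.length < c'.length)
    (hv : P.ValidChain c) (hc : ∀ b ∈ c, b ∈ S) (X A : Finset Slot)
    (h : ∀ x ∈ X, ∃ s ∈ A, P.CorruptAt S c x s) : X.card ≤ A.card := by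
  refine Finset.card_le_card_of_forall_subsingleton (P.CorruptAt S c) h fun s _ => ?_
  rintro x ⟨-, b, hb, hbh, rfl, y, t, hy, -, rfl, d, hd, hdn⟩
    x' ⟨-, b', hb', hbh', rfl, y', t', hy', -, hyy', d', hd', hdn'⟩
  obtain rfl : y' = y := hv.eq_of_slot_eq (hy'.subset (by simp)) (hy.subset (by simp)) hyy'
  have heq : y' :: t = y' :: t' :=
    (ChainParams.ChainTo.of_suffix hv hc hy).unique hg hS (.of_suffix hv hc hy')
  rw [← heq] at hdn'
  rcases lt_trichotomy b.slot b'.slot with hlt | heq | hlt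
  · have := hgrowth b hb b' hb' hbh hbh' hlt d d' hd hd'
    omega
  · exact heq
  · have := hgrowth b' hb' b hb hbh' hbh hlt d' d hd' hd
    omega

/-- Two valid chains that have at least the height of every honest block of a super slot up to
`N.slot - 2` agree up to slot `k`, or the bad event occurs. With `b₀` the newest common honest
block, the bad event is witnessed by the slot after `b₀`. -/
theorem chainPrefix_or_badEvent
    (hgh : P.honest P.genesis.bid = true) (hg : P.genesis.slot = 0)
    (hcorrupt : ∀ p sl, P.winner p sl = true → P.honest p = false → p ∈ P.initParties)
    (hS : CollisionFree N) (hi : P.Inv {b | b ∈ N.blockHistory} N) (k : Slot)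
    {c₁ c₂ : Chain Party Txs Hash} (hv₁ : P.ValidChain c₁) (hv₂ : P.ValidChain c₂)
    (hm₁ : ∀ b ∈ c₁, b ∈ N.blockHistory) (hm₂ : ∀ b ∈ c₂, b ∈ N.blockHistory)
    (hs₁ : ∀ b ∈ c₁, b.slot < N.slot) (hs₂ : ∀ b ∈ c₂, b.slot < N.slot)
    (hheight : ∀ x, P.SuperSlot x → 1 ≤ x → x < N.slot - 1 →
      ∃ b ∈ N.blockHistory, P.honest b.bid = true ∧ b.slot = x ∧
        ∃ n, P.HasHeight {b | b ∈ N.blockHistory} b n ∧ n ≤ c₁.length ∧ n ≤ c₂.length) :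
    ChainPrefix (prune k c₁) c₂ ∨ P.BadEvent k N.slot := by
  classical
  set S : Set (Block Party Txs Hash) := {b | b ∈ N.blockHistory}
  have hgrowth := hi.hist.growth
  obtain ⟨b₀, hb₀, hmax⟩ := Finset.exists_max_image
    (c₁.toFinset.filter fun b => b ∈ c₂ ∧ P.honest b.bid = true) Block.slot
    ⟨P.genesis, by simp [hv₁.genesis_mem, hv₂.genesis_mem, hgh]⟩
  simp only [Finset.mem_filter, List.mem_toFinset] at hb₀ hmax
  obtain ⟨hb₁, hb₂, hb₀h⟩ := hb₀
  obtain ⟨d, hd₁⟩ := exists_suffix_of_mem hb₁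
  obtain ⟨d', hd₂⟩ := exists_suffix_of_mem hb₂
  have hdd : b₀ :: d = b₀ :: d' :=
    (ChainParams.ChainTo.of_suffix (S := S) hv₁ hm₁ hd₁).unique hg hS (.of_suffix hv₂ hm₂ hd₂)
  rw [← hdd] at hd₂
  rcases le_or_gt k b₀.slot with hk | hk
  · exact .inl ((prune_suffix_of_le hv₁ hd₁ hk).trans hd₂)
  refine .inr ⟨b₀.slot + 1, Nat.le_add_left 1 _, hk, ?_⟩
  set A := (Finset.Ico (b₀.slot + 1) N.slot).filter fun x => P.AdvSlot x
  set X := (Finset.Ico (b₀.slot + 1) (N.slot - 1)).filter fun x => P.SuperSlot x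
  have hadv : ∀ {c : Chain Party Txs Hash} {y : Block Party Txs Hash}, P.ValidChain c → y ∈ c →
      y.slot < N.slot → b₀.slot < y.slot → P.honest y.bid = false → y.slot ∈ A := by
    intro c y hv hy hlt hlt₀ hh
    have hw : P.winner y.bid y.slot = true := hv.1 y hy
    exact Finset.mem_filter.2 ⟨Finset.mem_Ico.2 ⟨hlt₀, hlt⟩, y.bid, hcorrupt _ _ hw hh, hw, hh⟩
  have key : ∀ x ∈ X, (∃ s ∈ A, P.CorruptAt S c₁ x s) ∨ ∃ s ∈ A, P.CorruptAt S c₂ x s := by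
    intro x hx
    obtain ⟨hxI, hxs⟩ := Finset.mem_filter.1 hx
    obtain ⟨hx0, hxN⟩ := Finset.mem_Ico.1 hxI
    obtain ⟨b, hb, hbh, rfl, n, ⟨c, hc, rfl⟩, hn₁, hn₂⟩ :=
      hheight x hxs (le_trans (Nat.le_add_left 1 _) hx0) hxN
    have hlt := hgrowth b₀ (hm₁ b₀ hb₁) b hb hb₀h hbh hx0 (b₀ :: d) c
      (.of_suffix hv₁ hm₁ hd₁) hc
    obtain ⟨y₁, t₁, hy₁, hl₁, hlt₁⟩ := exists_suffix_of_length hv₁ hd₁ hlt hn₁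
    obtain ⟨y₂, t₂, hy₂, hl₂, hlt₂⟩ := exists_suffix_of_length hv₂ hd₂ hlt hn₂
    have hyc₁ : y₁ ∈ c₁ := hy₁.subset (by simp)
    have hyc₂ : y₂ ∈ c₂ := hy₂.subset (by simp)
    -- By growth, an honest block of the height of `b` has the slot of `b`, and a super slot has
    -- only one honest block.
    have heq : ∀ {y t}, P.ChainTo S y (y :: t) → (y :: t).length = c.length →
        P.honest y.bid = true → y = b := by
      intro y t hyt hlen hyh
      have hyS : y ∈ N.blockHistory := hyt.2.1 y (by simp)
      have hslot : y.slot = b.slot := by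
        rcases lt_trichotomy y.slot b.slot with h | h | h
        · have := hgrowth y hyS b hb hyh hbh h _ _ hyt hc
          omega
        · exact h
        · have := hgrowth b hb y hyS hbh hyh h _ _ hc hyt
          omega
      have hinit : ∀ {z : Block Party Txs Hash}, z ∈ N.blockHistory → P.honest z.bid = true →
          z.slot = b.slot → z.bid ∈ P.initParties := by
        intro z hz hzh hzs
        rcases hi.hist.genesis_or z hz hzh with rfl | h
        · lia
        · exact h.2
      refine hi.hist.unique y hyS b hb hyh (hxs.unique ⟨hinit hyS hyh hslot, ?_, hyh⟩
        ⟨hinit hb hbh rfl, ?_, hbh⟩) hslot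
      · rw [← hslot]
        exact hyt.1.1 y (by simp)
      · exact hc.1.1 b (List.mem_of_mem_head? hc.2.2)
    rcases hh₁ : P.honest y₁.bid with _ | _
    · exact .inl ⟨y₁.slot, hadv hv₁ hyc₁ (hs₁ _ hyc₁) hlt₁ hh₁, b, hb, hbh, rfl, y₁, t₁, hy₁,
        hh₁, rfl, c, hc, hl₁.symm⟩
    rcases hh₂ : P.honest y₂.bid with _ | _
    · exact .inr ⟨y₂.slot, hadv hv₂ hyc₂ (hs₂ _ hyc₂) hlt₂ hh₂, b, hb, hbh, rfl, y₂, t₂, hy₂,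
        hh₂, rfl, c, hc, hl₂.symm⟩
    obtain rfl := heq (.of_suffix hv₁ hm₁ hy₁) hl₁ hh₁
    obtain rfl := heq (.of_suffix hv₂ hm₂ hy₂) hl₂ hh₂
    have := hmax y₂ ⟨hyc₁, hyc₂, hh₂⟩
    lia
  have h₁ := card_corruptAt_le hg hS hgrowth hv₁ hm₁
    (X.filter fun x => ∃ s ∈ A, P.CorruptAt S c₁ x s) A fun x hx => (Finset.mem_filter.1 hx).2
  have h₂ := card_corruptAt_le hg hS hgrowth hv₂ hm₂
    (X.filter fun x => ∃ s ∈ A, P.CorruptAt S c₂ x s) A fun x hx => (Finset.mem_filter.1 hx).2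
  have hunion : X ⊆ (X.filter fun x => ∃ s ∈ A, P.CorruptAt S c₁ x s) ∪
      X.filter fun x => ∃ s ∈ A, P.CorruptAt S c₂ x s := by
    intro x hx
    exact Finset.mem_union.2 ((key x hx).imp (fun h => Finset.mem_filter.2 ⟨hx, h⟩)
      fun h => Finset.mem_filter.2 ⟨hx, h⟩)
  have hcard := (Finset.card_le_card hunion).trans (Finset.card_union_le _ _)
  have hXe : P.numSuper (b₀.slot + 1) (N.slot - 1) = X.card := rfl
  have hAe : P.numAdv (b₀.slot + 1) N.slot = A.card := rfl
  rw [hXe, hAe]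
  omega

end CommonPrefix

end PoSNSB

theorem mainTheorem2 {Party Txs Hash AdvState : Type*} [DecidableEq Party]
    (P : PoSNSB.Protocol Party Txs Hash AdvState)
    (hgenesisHonest : P.honest P.genesis.bid = true)
    (hgenesisSlot : P.genesis.slot = 0)
    (hnodup : P.initParties.Nodup)
    (hcorrupt : ∀ p sl, P.winner p sl = true → P.honest p = false → p ∈ P.initParties)
    (N : PoSNSB.GlobalState AdvState P.toChainParams)
    (hreach : P.Reachable P.init N)
    (hforging : P.ForgingFree N)
    (hcollision : PoSNSB.CollisionFree N)
    (k : PoSNSB.Slot) :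
    (∀ (p : Party) (l : PoSNSB.LocalState P.toChainParams) (c : PoSNSB.Chain Party Txs Hash),
      P.honest p = true → N.stateMap p = some l →
      (∀ b ∈ c, b ∈ N.blockHistory) → P.ValidChain c → (∀ b ∈ c, b.slot < N.slot) →
      (l.best (N.slot - 1)).length ≤ c.length →
      PoSNSB.ChainPrefix (PoSNSB.prune k (l.best (N.slot - 1))) c ∨ P.BadEvent k N.slot) ∧
    (∀ (p₁ p₂ : Party) (l₁ l₂ : PoSNSB.LocalState P.toChainParams),
      P.honest p₁ = true → N.stateMap p₁ = some l₁ →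
      P.honest p₂ = true → N.stateMap p₂ = some l₂ →
      PoSNSB.ChainPrefix (PoSNSB.prune k (l₁.best (N.slot - 1))) (l₂.best (N.slot - 1)) ∨
        P.BadEvent k N.slot) := by
  have hi := PoSNSB.inv_of_reachable hgenesisSlot hnodup hforging hcollision hreach .refl
  have hpos : 1 ≤ N.slot := hi.hist.slot_pos
  have hmem : ∀ p l, N.stateMap p = some l →
      ∀ b ∈ l.best (N.slot - 1), b ∈ N.blockHistory ∧ b.slot < N.slot := by
    intro p l hl b hb
    obtain ⟨h1, h2⟩ := l.tT.selfContained l.tree (N.slot - 1) b hb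
    exact ⟨hi.state.tree_sub p l hl b h1, by lia⟩
  constructor
  · intro p l c hp hl hcm hcv hcs hlen
    refine PoSNSB.chainPrefix_or_badEvent hgenesisHonest hgenesisSlot hcorrupt hcollision hi k
      (l.tT.valid _ _) hcv (fun b hb => (hmem p l hl b hb).1) hcm
      (fun b hb => (hmem p l hl b hb).2) hcs fun x hx hx1 hxN => ?_
    obtain ⟨b, h1, h2, h3, n, h4, h5⟩ := hi.exists_height hx hx1 hxN
    exact ⟨b, h1, h2, h3, n, h4, h5 p l hp hl, (h5 p l hp hl).trans hlen⟩
  · intro p₁ p₂ l₁ l₂ hp₁ hl₁ hp₂ hl₂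
    refine PoSNSB.chainPrefix_or_badEvent hgenesisHonest hgenesisSlot hcorrupt hcollision hi k
      (l₁.tT.valid _ _) (l₂.tT.valid _ _) (fun b hb => (hmem p₁ l₁ hl₁ b hb).1)
      (fun b hb => (hmem p₂ l₂ hl₂ b hb).1) (fun b hb => (hmem p₁ l₁ hl₁ b hb).2)
      (fun b hb => (hmem p₂ l₂ hl₂ b hb).2) fun x hx hx1 hxN => ?_
    obtain ⟨b, h1, h2, h3, n, h4, h5⟩ := hi.exists_height hx hx1 hxN
    exact ⟨b, h1, h2, h3, n, h4, h5 p₁ l₁ hp₁ hl₁, h5 p₂ l₂ hp₂ hl₂⟩
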